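/- Let $M$ be a matroid with closure operator $\operatorname{cl}$ and rank function $\operatorname{rk}$. For distinct elements $y,x,z,o,q,r,s$ of $M$ write $\mathrm{HP}(y,x,z;o,q,r,s)$ if the restriction $M|\{y,x,z,o,q,r,s\}$ is the rank-3 simple matroid whose three-point lines are either exactly the six sets $$\{y,x,z\},\ \{x,q,s\},\ \{y,o,q\},\ \{y,r,s\},\ \{z,o,s\},\ \{z,q,r\}$$ (the non-Fano matroid $F_7^-$) or exactly these six sets together with $\{x,o,r\}$ (the Fano matroid $F_7$). Write $\mathrm{H}(y,z;x,x')$, and call $x'$ a harmonic conjugate of $x$ with respect to $y$ and $z$, if there are $o,q,r,s$ with $\mathrm{HP}(y,x,z;o,q,r,s)$ and $\operatorname{cl}(\{y,z\})\cap\operatorname{cl}(\{o,r\})=\{x'\}$. The matroid $M$ is harmonic if for every $\mathrm{HP}(y,x,z;o,q,r,s)$ in $M$ the set $\operatorname{cl}(\{y,z\})\cap\operatorname{cl}(\{o,r\})$ consists of exactly one element $x'$, and $x'$ depends only on $y,x,z$. For a set $S$ of elements of $M$ let $h(S)=S\cup\{x\in M:\ \mathrm{H}(a,c;b,x)\text{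 for some }a,b,c\in S\}$ and $h^\infty(S)=\bigcup_{n\ge 0}h^n(S)$. The set $S$ is harmonically closed if $h^\infty(S)=S$; it is a Möbius harmonic net if moreover it is collinear, i.e. $\operatorname{rk}(S)\le 2$. A conjugate sequence in $M$ is an infinite sequence of elements $d,b_0,b_1,b_2,\dots$ such that $\mathrm{H}(d,b_i;b_{i-1},b_{i+1})$ for all $i\ge 1$. It is modular if at least one of its points is equal to one of the preceding points. **Corollary.** Let $M$ be a harmonic matroid and let $d,b_0,b_1,\dots$ be a modular conjugate sequence in $M$. Then the set $\{d\}\cup\{b_i: i\ge 0\}$ of its points is a Möbius harmonic net. Moreover, if $b_n$ is the first point of the sequence that is equal to one of its preceding points, then $\{d,b_0,\dots,b_{n-1}\}$ is a Möbius harmonic net. -/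

import Mathlib

/-- The matroid of rank (at most) three on seven labelled elements whose dependent sets of at most
three elements are exactly the members of `L`, where `L` is a family of three-element sets, any
two of which meet in at most one element. -/
def sevenPointMatroid (L : Finset (Finset (Fin 7))) (h3 : ∀ l ∈ L, l.card = 3)
    (hL : ∀ l ∈ L, ∀ l' ∈ L, l ≠ l' → (l ∩ l').card ≤ 1) : Matroid (Fin 7) :=
  (IndepMatroid.ofFinset Set.univ (fun I : Finset (Fin 7) => I.card ≤ 3 ∧ I ∉ L)
    ⟨by simp, fun h => by simpa using h3 _ h⟩
    (by
      rintro I J ⟨hJ, hJL⟩ hIJ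
      refine ⟨(Finset.card_le_card hIJ).trans hJ, fun hI => hJL ?_⟩
      have : I = J := Finset.eq_of_subset_of_card_le hIJ (by rw [h3 I hI]; exact hJ)
      exact this ▸ hI)
    (by
      rintro I J ⟨hI, hIL⟩ ⟨hJ, hJL⟩ hlt
      obtain ⟨e, heJ, heI⟩ := Finset.exists_mem_notMem_of_card_lt_card hlt
      by_contra! hcon
      have key : ∀ f ∈ J, f ∉ I → insert f I ∈ L := fun f hfJ hfI => by
        by_contra hf
        exact hf (hcon f hfJ hfI (by rw [Finset.card_insert_of_notMem hfI]; omega))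
      have hI2 : I.card = 2 := by
        have := h3 _ (key e heJ heI)
        rw [Finset.card_insert_of_notMem heI] at this
        omega
      have hsub : J ⊆ insert e I := by
        intro f hfJ
        by_cases hfI : f ∈ I
        · exact Finset.mem_insert_of_mem hfI
        · have heq : insert f I = insert e I := by
            by_contra hne
            have h1 := hL _ (key f hfJ hfI) _ (key e heJ heI) hne
            have h2 : I ⊆ insert f I ∩ insert e I :=
              Finset.subset_inter (Finset.subset_insert _ _) (Finset.subset_insert _ _)
            have h4 := Finset.card_le_card h2
            omega
          rw [← heq]
          exact Finset.mem_insert_self _ _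
      have hEq : J = insert e I := Finset.eq_of_subset_of_card_le hsub (by
        rw [Finset.card_insert_of_notMem heI]; omega)
      exact hJL (hEq ▸ key e heJ heI))
    (fun _ _ => Set.subset_univ _)).matroid

/-- The six three-point lines of the non-Fano matroid. The elements `0, 1, 2, 3, 4, 5, 6` are the
labels `y, x, z, o, q, r, s`, so that the lines are `yxz, xqs, yoq, yrs, zos, zqr`. -/
def nonFanoLines : Finset (Finset (Fin 7)) :=
  {{0, 1, 2}, {1, 4, 6}, {0, 3, 4}, {0, 5, 6}, {2, 3, 6}, {2, 4, 5}}

/-- The seven lines of the Fano matroid: the six lines of the non-Fano matroid and `xor`. -/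
def fanoLines : Finset (Finset (Fin 7)) := insert {1, 3, 5} nonFanoLines

set_option maxRecDepth 8000 in
/-- The (labelled) non-Fano matroid `F₇⁻`. -/
def nonFanoMatroid : Matroid (Fin 7) := sevenPointMatroid nonFanoLines (by decide) (by decide)

set_option maxRecDepth 8000 in
/-- The (labelled) Fano matroid `F₇`. -/
def fanoMatroid : Matroid (Fin 7) := sevenPointMatroid fanoLines (by decide) (by decide)

namespace Matroid

variable {α : Type*}

/-- `HP(y, x, z; o, q, r, s)`: the seven elements are distinct elements of `M`, and the restriction
of `M` to them is, under the labelling `0, …, 6 ↦ y, x, z, o, q, r, s`, the Fano or the non-Fano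
matroid. -/
def IsHP (M : Matroid α) (y x z o q r s : α) : Prop :=
  Function.Injective ![y, x, z, o, q, r, s] ∧ Set.range ![y, x, z, o, q, r, s] ⊆ M.E ∧
    ((M ↾ Set.range ![y, x, z, o, q, r, s]).comap ![y, x, z, o, q, r, s] = fanoMatroid ∨
      (M ↾ Set.range ![y, x, z, o, q, r, s]).comap ![y, x, z, o, q, r, s] = nonFanoMatroid)

/-- `Hc(y, z; x, x')`: `x'` is a harmonic conjugate of `x` with respect to `y` and `z`. -/
def IsHarmonicConjugate (M : Matroid α) (y z x x' : α) : Prop :=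
  ∃ o q r s, M.IsHP y x z o q r s ∧ M.closure {y, z} ∩ M.closure {o, r} = {x'}

/-- A harmonic matroid: every `HP(y, x, z; o, q, r, s)` gives rise to a harmonic conjugate of `x`
with respect to `y` and `z`, and this conjugate depends only on `y, x, z`. -/
def IsHarmonic (M : Matroid α) : Prop :=
  (∀ y x z o q r s, M.IsHP y x z o q r s →
    ∃ x', M.closure {y, z} ∩ M.closure {o, r} = {x'}) ∧
  ∀ y x z x' x'', M.IsHarmonicConjugate y z x x' → M.IsHarmonicConjugate y z x x'' → x' = x''

/-- The map `h`, which adjoins to `S` all harmonic conjugates `x` with `Hc(a, c; b, x)` for some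
`a, b, c ∈ S`. -/
def harmonicStep (M : Matroid α) (S : Set α) : Set α :=
  S ∪ {x ∈ M.E | ∃ a ∈ S, ∃ b ∈ S, ∃ c ∈ S, M.IsHarmonicConjugate a c b x}

/-- The harmonic closure `h^∞(S) = ⋃ₙ hⁿ(S)`. -/
def harmonicClosure (M : Matroid α) (S : Set α) : Set α :=
  ⋃ n : ℕ, (M.harmonicStep)^[n] S

/-- A set of elements of `M` is harmonically closed if it is equal to its harmonic closure. -/
def IsHarmonicallyClosed (M : Matroid α) (S : Set α) : Prop :=
  M.harmonicClosure S = S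

/-- A set of elements of `M` is collinear if its rank is at most two. -/
def IsCollinear (M : Matroid α) (S : Set α) : Prop :=
  S ⊆ M.E ∧ M.eRk S ≤ 2

/-- A Möbius harmonic net (given by its set of points): a harmonically closed collinear set. -/
def IsMoebiusHarmonicNet (M : Matroid α) (S : Set α) : Prop :=
  M.IsCollinear S ∧ M.IsHarmonicallyClosed S

/-- A conjugate sequence `A, a₀, a₁, …`: `Hc(A, aᵢ; aᵢ₋₁, aᵢ₊₁)` for every `i ≥ 1`. -/
def IsConjugateSequence (M : Matroid α) (A : α) (a : ℕ → α) : Prop :=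
  ∀ i, M.IsHarmonicConjugate A (a (i + 1)) (a i) (a (i + 2))

end Matroid

/-- In the sequence `A, a₀, a₁, …` the point `aₙ` is equal to one of the preceding points. -/
def RepeatsAt {α : Type*} (A : α) (a : ℕ → α) (n : ℕ) : Prop :=
  a n = A ∨ ∃ m < n, a n = a m

/-- A sequence `A, a₀, a₁, …` is modular if one of its points is equal to a preceding point. -/
def IsModularSequence {α : Type*} (A : α) (a : ℕ → α) : Prop :=
  ∃ n, RepeatsAt A a n

/-! Replace elements by points, the closures of single elements, with three points collinear when
their rank is at most two. For a harmonic matroid without loops this is an `IsHarmonicCollinearity`,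
and the six lines with a few nondegeneracy conditions (`HarmonicConfig`) are equivalent to `IsHP`.
The rest is plane geometry.

Take the line DQ of the first quadrangle as line at infinity, O being a third point on it. The
sequence is then a row of equally spaced points in direction D. Existence and uniqueness of
conjugates replace Desargues' theorem: the points where the lines of direction Q through b i meet
the lines of direction O through b (i+1) form a second row (`exists_strip`), and every strip has a
next row (`Strip.exists_next`). Projecting between two rows gives b (i+1) = b (j+1) iff b i = b j,
so the first repetition is b n = b 0 and the sequence has period n.

Stacking n rows closes up to a grid indexed by (ℤ/n)² (`Grid.exists_of_strip`). The diagonals of its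
parallelograms are concurrent at a harmonic conjugate (`Grid.shear`), and iteration yields a point
at infinity for every slope. If n were composite, some line of nonzero slope would meet a column
twice, so n is prime (`Grid.prime`) and the grid is coordinatized by a field. The row with D is the
projective line over ℤ/n, and explicit quadrangles inside the grid construct a conjugate in it for
any three of its points (`CoordPlane.exists_harmonicConj`). By uniqueness there is no other
conjugate, so the set is closed.

Back in the matroid, a harmonic conjugate is alone in its parallel class, because the two closures
meet in a single element; equality of points of the sequence is therefore equality of elements. -/

/-- A collinearity relation on the points of a linear space. -/
structure IsCollinearity {β : Type*} (C : β → β → β → Prop) : Prop where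
  refl : ∀ a b, C a a b
  rot : ∀ {a b c}, C a b c → C b c a
  swap : ∀ {a b c}, C a b c → C b a c
  trans : ∀ {a b c e}, a ≠ b → C a b c → C a b e → C a c e

/-- A labelled harmonic configuration: the complete quadrangle `o, q, r, s` with its diagonal
points `y` and `z`, and the point `x` in which `qs` meets `yz`. -/
structure HarmonicConfig {β : Type*} (C : β → β → β → Prop) (y x z o q r s : β) : Prop where
  yxz : C y x z
  xqs : C x q s
  yoq : C y o q
  yrs : C y r s
  zos : C z o s
  zqr : C z q r
  nyzq : ¬ C y z q
  xy : x ≠ y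
  xz : x ≠ z
  oy : o ≠ y
  oq : o ≠ q

/-- A collinearity relation in which harmonic conjugates exist and are unique. -/
structure IsHarmonicCollinearity {β : Type*} (C : β → β → β → Prop) : Prop
    extends IsCollinearity C where
  exists_conj : ∀ {y x z o q r s}, HarmonicConfig C y x z o q r s → ∃ x', C y z x' ∧ C o r x'
  conj_unique : ∀ {y x z o q r s o' q' r' s' x' x''},
    HarmonicConfig C y x z o q r s → C y z x' → C o r x' →
    HarmonicConfig C y x z o' q' r' s' → C y z x'' → C o' r' x'' → x' = x''

/-! ### Collinearity relations, conjugates and directions -/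

section Geometry

variable {β : Type*} {C : β → β → β → Prop}

namespace IsCollinearity

theorem swap_right (h : IsCollinearity C) {a b c : β} (H : C a b c) : C a c b :=
  h.swap (h.rot (h.rot H))

theorem rot_right (h : IsCollinearity C) {a b c : β} (H : C a b c) : C c a b := h.rot (h.rot H)

theorem refl_right (h : IsCollinearity C) (a b : β) : C a b b := h.rot_right (h.refl b a)

/-- Points on the lines through a common point. -/
theorem join (h : IsCollinearity C) {d a b c : β} (hd : d ≠ a) (h1 : C d a b) (h2 : C d a c) :
    C d b c := h.trans hd h1 h2

/-- Two lines in different directions `d` and `q` meet in one point. -/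
theorem eq_of_col (h : IsCollinearity C) {d q x y : β} (hx : ¬ C d q x) (h1 : C d x y)
    (h2 : C q x y) : x = y := by
  by_contra hne
  exact hx (h.rot (h.trans hne (h.rot h1) (h.rot h2)))

end IsCollinearity

/-- The substitute for Desargues' theorem: two configurations on the same triple y, x, z have the
same conjugate, so a point constructed from one quadrangle is incident with a line of the other. -/
theorem IsHarmonicCollinearity.conj_col (h : IsHarmonicCollinearity C)
    {y x z o q r s o' q' r' s' x' : β} (H : HarmonicConfig C y x z o q r s) (h1 : C y z x')
    (h2 : C o r x') (H' : HarmonicConfig C y x z o' q' r' s') : C o' r' x' := by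
  obtain ⟨x'', h3, h4⟩ := h.exists_conj H'
  rwa [h.conj_unique H h1 h2 H' h3 h4]

/-- Three distinct collinear points, the directions of a triangular grid. -/
structure Directions (C : β → β → β → Prop) (D Q O : β) : Prop where
  dq : D ≠ Q
  od : O ≠ D
  oq : O ≠ Q
  col : C D Q O

namespace Directions

variable {D Q O : β}

theorem affine_do (h : IsCollinearity C) (F : Directions C D Q O) {x : β} (hx : ¬ C D Q x) :
    ¬ C D O x := fun H => hx (h.trans F.od.symm (h.swap_right F.col) H)

theorem affine_qo (h : IsCollinearity C) (F : Directions C D Q O) {x : β} (hx : ¬ C D Q x) :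
    ¬ C Q O x := fun H => hx (h.swap (h.trans F.oq.symm (h.swap_right (h.swap F.col)) H))

theorem ne_d (h : IsCollinearity C) {x : β} (hx : ¬ C D Q x) : x ≠ D := by
  rintro rfl; exact hx (h.rot (h.refl _ _))

theorem ne_q (h : IsCollinearity C) {x : β} (hx : ¬ C D Q x) : x ≠ Q := by
  rintro rfl; exact hx (h.refl_right _ _)

theorem ne_o (F : Directions C D Q O) {x : β} (hx : ¬ C D Q x) : x ≠ O := by
  rintro rfl; exact hx F.col

theorem swap (h : IsCollinearity C) (F : Directions C D Q O) : Directions C Q D O :=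
  ⟨F.dq.symm, F.oq, F.od, h.swap F.col⟩

/-- A point collinear in direction `Q` and in direction `O` with affine points is affine. -/
theorem affine_of_col (h : IsCollinearity C) (F : Directions C D Q O) {x y r : β}
    (hx : ¬ C D Q x) (hy : ¬ C D Q y) (h1 : C Q x r) (h2 : C O y r) : ¬ C D Q r := by
  intro hr
  have := F.dq; have := F.od; have := F.oq; have := F.col
  grind [h.rot, h.swap, h.trans]

end Directions
/-- `x'` is a harmonic conjugate of `x` with respect to `y` and `z`. -/
def HarmonicConj (C : β → β → β → Prop) (y z x x' : β) : Prop :=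
  ∃ o q r s, HarmonicConfig C y x z o q r s ∧ C y z x' ∧ C o r x'

/-! ### Strips: adding rows, and periodicity of a row -/

/-- Two consecutive rows `a` and `r` of a triangular grid with directions `D`, `Q`, `O`. -/
structure Strip (C : β → β → β → Prop) (D Q O : β) {ι : Type*} [Add ι] [One ι]
    (a r : ι → β) : Prop where
  affine : ∀ i, ¬ C D Q (a i)
  ne : ∀ i, a i ≠ a (i + 1)
  row : ∀ i, C D (a i) (a (i + 1))
  row' : ∀ i, C D (r i) (r (i + 1))
  col : ∀ i, C Q (a i) (r i)
  diag : ∀ i, C O (a (i + 1)) (r i)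

namespace Strip

variable {D Q O : β} {ι : Type*} [Add ι] [One ι] {a r : ι → β}

theorem affine' (h : IsCollinearity C) (F : Directions C D Q O) (S : Strip C D Q O a r) (i : ι) :
    ¬ C D Q (r i) :=
  F.affine_of_col h (S.affine i) (S.affine (i + 1)) (S.col i) (S.diag i)

theorem ne' (h : IsCollinearity C) (F : Directions C D Q O) (S : Strip C D Q O a r) (i : ι) :
    r i ≠ r (i + 1) := by
  have h1 := S.col i
  have h2 := S.col (i + 1)
  have h3 := S.affine' h F i
  have h4 := S.row i
  have h5 := S.affine i
  have h6 := S.ne i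
  intro h7
  rw [← h7] at h2
  have : C Q (a i) (a (i + 1)) := by grind [h.rot, h.swap, h.trans, h.refl]
  exact h6 (h.eq_of_col h5 h4 this)

theorem ne_col (h : IsCollinearity C) (F : Directions C D Q O) (S : Strip C D Q O a r) (i : ι) :
    a i ≠ r i := by
  intro h7
  have h1 := S.diag i
  rw [← h7] at h1
  exact S.ne i (h.eq_of_col (F.affine_do h (S.affine i)) (S.row i) (h.swap_right h1))

theorem ne_diag (h : IsCollinearity C) (S : Strip C D Q O a r) (i : ι) :
    a (i + 1) ≠ r i := by
  intro h7
  have h1 := S.col i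
  rw [← h7] at h1
  exact S.ne i (h.eq_of_col (S.affine i) (S.row i) h1)

/-- The new point t i is the conjugate of a i with respect to Q and r i, which lies on the line of
direction O through r (i+1). The issue is that the new points form a row in direction D. -/
theorem exists_next (h : IsHarmonicCollinearity C) (F : Directions C D Q O)
    (S : Strip C D Q O a r) : ∃ t, Strip C D Q O r t := by
  have hC := h.toIsCollinearity
  have H1 : ∀ i, HarmonicConfig C Q (a i) (r i) O D (r (i + 1)) (a (i + 1)) := fun i =>
    { yxz := S.col i
      xqs := hC.swap (S.row i)
      yoq := by have := F.col; grind [hC.rot, hC.swap]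
      yrs := hC.swap_right (S.col (i + 1))
      zos := by have := S.diag i; grind [hC.rot, hC.swap]
      zqr := hC.swap (S.row' i)
      nyzq := by have := S.affine' hC F i; grind [hC.rot, hC.swap]
      xy := Directions.ne_q hC (S.affine i)
      xz := S.ne_col hC F i
      oy := F.oq
      oq := F.od }
  choose t ht1 ht2 using fun i => h.exists_conj (H1 i)
  refine ⟨t, S.affine' hC F, S.ne' hC F, S.row', fun i => ?_, ht1, ht2⟩
  have S' : ∀ i, ¬ C D Q (t i) := fun i =>
    F.affine_of_col hC (S.affine' hC F i) (S.affine' hC F (i + 1)) (ht1 i) (ht2 i)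
  have hO := F.affine_qo hC (S.affine' hC F (i + 1))
  have hO' := F.affine_do hC (S.affine' hC F (i + 1))
  have hcol := F.col
  have e1 := S.row (i + 1)
  have e2 := S.col (i + 1)
  have e3 := S.diag i
  have e4 := S.diag (i + 1)
  have e5 := S.row' i
  have e6 := S.row' (i + 1)
  have e7 := S.col (i + 1 + 1)
  -- The conjugate of a (i+2) with respect to O and r (i+1) is found twice: `H2` gives t i, and `H3`
  -- puts it on the line joining D to t (i+1).
  have H2 : HarmonicConfig C O (a (i + 1 + 1)) (r (i + 1)) Q D (r i) (a (i + 1)) :=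
    { yxz := e4
      xqs := by grind [hC.rot, hC.swap]
      yoq := by grind [hC.rot, hC.swap]
      yrs := by grind [hC.rot, hC.swap]
      zos := by grind [hC.rot, hC.swap]
      zqr := by grind [hC.rot, hC.swap]
      nyzq := by grind [hC.rot, hC.swap]
      xy := F.ne_o (S.affine _)
      xz := S.ne_diag hC _
      oy := F.oq.symm
      oq := F.dq.symm }
  have f1 := ht1 (i + 1)
  have f2 := ht2 (i + 1)
  have H3 : HarmonicConfig C O (a (i + 1 + 1)) (r (i + 1)) D Q (t (i + 1)) (r (i + 1 + 1)) :=
    { yxz := e4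
      xqs := by grind [hC.rot, hC.swap]
      yoq := by grind [hC.rot, hC.swap]
      yrs := by grind [hC.rot, hC.swap]
      zos := by grind [hC.rot, hC.swap]
      zqr := by grind [hC.rot, hC.swap]
      nyzq := by grind [hC.rot, hC.swap]
      xy := F.ne_o (S.affine _)
      xz := S.ne_diag hC _
      oy := F.od.symm
      oq := F.dq }
  have := h.conj_col H2 (ht2 i) (by have := ht1 i; grind [hC.rot, hC.swap]) H3
  exact hC.swap_right this

end Strip

/-- The conjugate sequence on a line is the first row of a strip. -/
theorem exists_strip (h : IsHarmonicCollinearity C) {D : β} {b : ℕ → β}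
    (hb : ∀ i, HarmonicConj C D (b (i + 1)) (b i) (b (i + 1 + 1))) :
    ∃ Q O r, Directions C D Q O ∧ Strip C D Q O b r := by
  have hC := h.toIsCollinearity
  obtain ⟨O, Q, r₁, s, H, hx1, hx2⟩ := hb 0
  have F : Directions C D Q O :=
    ⟨by rintro rfl; exact H.nyzq (hC.rot (hC.refl _ _)), H.oy, H.oq, hC.swap_right H.yoq⟩
  have hD : ∀ i, D ≠ b i := fun i => by
    obtain ⟨_, _, _, _, H, -⟩ := hb i
    exact H.xy.symm
  have hne : ∀ i, b i ≠ b (i + 1) := fun i => by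
    obtain ⟨_, _, _, _, H, -⟩ := hb i
    exact H.xz
  have hrow : ∀ i, C D (b i) (b (i + 1)) := fun i => by
    obtain ⟨_, _, _, _, H, -⟩ := hb i
    exact H.yxz
  have haff : ∀ i, ¬ C D Q (b i) := by
    have h0 : ¬ C D Q (b 1) := by have := H.nyzq; grind [hC.rot, hC.swap]
    have step : ∀ i, C D Q (b i) ↔ C D Q (b (i + 1)) := fun i => by
      have := hrow i; have := hD i; have := hD (i + 1); have := F.dq
      constructor <;> intro <;> grind [hC.rot, hC.swap, hC.trans]
    intro i
    induction i with
    | zero => rwa [step]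
    | succ i ih => rwa [← step]
  have hs : ¬ C D Q s := F.affine_of_col hC (haff 0) (haff 1)
    (by have := H.xqs; grind [hC.rot, hC.swap]) (by have := H.zos; grind [hC.rot, hC.swap])
  -- The second row is the line Ds, where s and r₁ of the first quadrangle are its points 0 and 1.
  -- Two consecutive points are carried along because the next one is constructed as the conjugate
  -- of the first with respect to D and the second.
  have key : ∀ i, (∃ r, C D s r ∧ C Q (b i) r ∧ C O (b (i + 1)) r) ∧
      ∃ r, C D s r ∧ C Q (b (i + 1)) r ∧ C O (b (i + 1 + 1)) r := by
    intro i
    induction i with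
    | zero =>
      have := H.xqs; have := H.zos; have := H.yrs; have := H.zqr
      exact ⟨⟨s, hC.refl_right _ _, by grind [hC.rot, hC.swap], by grind [hC.rot, hC.swap]⟩,
        ⟨r₁, by grind [hC.rot, hC.swap], by grind [hC.rot, hC.swap], by grind [hC.rot, hC.swap]⟩⟩
    | succ i ih =>
      refine ⟨ih.2, ?_⟩
      obtain ⟨⟨r, h1, h2, h3⟩, ⟨r', h1', h2', h3'⟩⟩ := ih
      have hr : ¬ C D Q r := F.affine_of_col hC (haff _) (haff _) h2 h3
      have hr' : ¬ C D Q r' := F.affine_of_col hC (haff _) (haff _) h2' h3'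
      have hrO := F.affine_do hC hr
      have hrO' := F.affine_do hC hr'
      have hrr : C D r r' := hC.join (Directions.ne_d hC hs).symm h1 h1'
      have e1 := hrow (i + 1)
      have hcol := F.col
      have hrne : r ≠ r' := by
        rintro rfl
        have : C Q (b i) (b (i + 1)) := by
          have := Directions.ne_q hC hr
          grind [hC.rot, hC.swap, hC.trans]
        exact hne i (hC.eq_of_col (haff i) (hrow i) this)
      have H1 : HarmonicConfig C D r r' Q O (b (i + 1 + 1)) (b (i + 1)) :=
        { yxz := hrr
          xqs := by grind [hC.rot, hC.swap]
          yoq := by grind [hC.rot, hC.swap]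
          yrs := by grind [hC.rot, hC.swap]
          zos := by grind [hC.rot, hC.swap]
          zqr := by grind [hC.rot, hC.swap]
          nyzq := by grind [hC.rot, hC.swap]
          xy := Directions.ne_d hC hr
          xz := hrne
          oy := F.dq.symm
          oq := F.oq.symm }
      obtain ⟨r'', g1, g2⟩ := h.exists_conj H1
      refine ⟨r'', ?_, ?_, ?_⟩
      · have := (Directions.ne_d hC hs); have := (Directions.ne_d hC hr')
        grind [hC.rot, hC.swap, hC.trans]
      · grind [hC.rot, hC.swap]
      -- Since b (i+3) is the conjugate of b (i+1) with respect to D and b (i+2), uniqueness puts it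
      -- on the line joining O to r''.
      obtain ⟨o, q, r₀, s₀, K, k1, k2⟩ := hb (i + 1)
      have hb2 := haff (i + 1 + 1)
      have H2 : HarmonicConfig C D (b (i + 1)) (b (i + 1 + 1)) O Q r'' r' :=
        { yxz := e1
          xqs := by grind [hC.rot, hC.swap]
          yoq := by grind [hC.rot, hC.swap]
          yrs := by grind [hC.rot, hC.swap]
          zos := by grind [hC.rot, hC.swap]
          zqr := by grind [hC.rot, hC.swap]
          nyzq := by grind [hC.rot, hC.swap]
          xy := (hD _).symm
          xz := hne _
          oy := F.od
          oq := F.oq }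
      exact hC.swap_right (h.conj_col K k1 k2 H2)
  choose r hr1 hr2 hr3 using fun i => (key i).1
  exact ⟨Q, O, r, F, haff, hne, hrow, fun i => hC.join (Directions.ne_d hC hs).symm (hr1 i) (hr1 _),
    hr2, hr3⟩

namespace Strip

variable {D Q O : β} {a r : ℕ → β}

theorem row_zero (h : IsCollinearity C) (S : Strip C D Q O a r) (i : ℕ) : C D (a 0) (a i) := by
  induction i with
  | zero => exact h.refl_right _ _
  | succ i ih =>
    have := Directions.ne_d h (S.affine i)
    have := S.row i
    grind [h.rot, h.swap, h.trans]

theorem row_zero' (h : IsCollinearity C) (F : Directions C D Q O) (S : Strip C D Q O a r) (i : ℕ) :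
    C D (r 0) (r i) := by
  induction i with
  | zero => exact h.refl_right _ _
  | succ i ih =>
    have := Directions.ne_d h (S.affine' h F i)
    have := S.row' i
    grind [h.rot, h.swap, h.trans]

/-- The shift of the row is a composite of two projections: from O onto the row r, taking a (i+1) to
r i, and from Q back, taking r i to a i. Both are injective. -/
theorem succ_eq_succ_iff (h : IsCollinearity C) (F : Directions C D Q O) (S : Strip C D Q O a r)
    (i j : ℕ) : a (i + 1) = a (j + 1) ↔ a i = a j := by
  have hr : C D (r i) (r j) := h.join (Directions.ne_d h (S.affine' h F 0)).symm
    (S.row_zero' h F i) (S.row_zero' h F j)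
  have ha : ∀ i j, C D (a i) (a j) := fun i j => h.join (Directions.ne_d h (S.affine 0)).symm
    (S.row_zero h i) (S.row_zero h j)
  constructor
  · intro H
    have h1 := S.diag i
    have h2 := S.diag j
    rw [← H] at h2
    have hij : r i = r j := h.eq_of_col (F.affine_do h (S.affine' h F i)) hr
      (h.join (F.ne_o (S.affine (i + 1))).symm h1 h2)
    have h3 := S.col i
    have h4 := S.col j
    rw [← hij] at h4
    have := Directions.ne_q h (S.affine' h F i)
    exact h.eq_of_col (S.affine i) (ha i j) (by grind [h.rot, h.swap, h.trans])
  · intro H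
    have h1 := S.col i
    have h2 := S.col j
    rw [← H] at h2
    have hij : r i = r j := h.eq_of_col (S.affine' h F i) hr
      (h.join (Directions.ne_q h (S.affine i)).symm h1 h2)
    have h3 := S.diag i
    have h4 := S.diag j
    rw [← hij] at h4
    have := F.ne_o (S.affine' h F i)
    exact h.eq_of_col (F.affine_do h (S.affine (i + 1))) (ha _ _)
      (by grind [h.rot, h.swap, h.trans])

/-- The first point of a row that repeats a point repeats the point with index `0`. -/
theorem eq_zero_of_first_repeat (h : IsCollinearity C) (F : Directions C D Q O)
    (S : Strip C D Q O a r) {m n : ℕ} (hmn : m < n) (H : a n = a m)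
    (hn : ∀ k < n, ∀ l < k, a k ≠ a l) : a n = a 0 := by
  rcases m with _ | m
  · exact H
  · obtain ⟨n, rfl⟩ : ∃ k, n = k + 1 := ⟨n - 1, by omega⟩
    exact absurd ((S.succ_eq_succ_iff h F n m).1 H) (hn n (by omega) m (by omega))

theorem periodic (h : IsCollinearity C) (F : Directions C D Q O) (S : Strip C D Q O a r) {n : ℕ}
    (H : a n = a 0) : Function.Periodic a n := by
  intro i
  induction i with
  | zero => simpa using H
  | succ i ih => rw [add_right_comm]; exact (S.succ_eq_succ_iff h F _ _).2 ih

theorem periodic' (h : IsCollinearity C) (F : Directions C D Q O) (S : Strip C D Q O a r) {n : ℕ}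
    (H : a n = a 0) : Function.Periodic r n := by
  intro i
  have hr : C D (r (i + n)) (r i) := h.join (Directions.ne_d h (S.affine' h F 0)).symm
    (S.row_zero' h F _) (S.row_zero' h F _)
  have h1 := S.col (i + n)
  rw [S.periodic h F H i] at h1
  exact h.eq_of_col (S.affine' h F _) hr
    (h.join (Directions.ne_q h (S.affine i)).symm h1 (S.col i))

/-- A periodic strip, indexed by the residues. -/
theorem zmod (S : Strip C D Q O a r) {n : ℕ} [NeZero n]
    (ha : Function.Periodic a n) (hr : Function.Periodic r n) :
    Strip C D Q O (fun i : ZMod n => a i.val) (fun i : ZMod n => r i.val) := by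
  have hs : ∀ (c : ℕ → β), Function.Periodic c n → ∀ i : ZMod n, c (i + 1).val = c (i.val + 1) := by
    intro c hc i
    rw [ZMod.val_add, hc.map_mod_nat, ← hc.map_mod_nat, Nat.add_mod, ZMod.val_one_eq_one_mod,
      Nat.mod_mod, ← Nat.add_mod, hc.map_mod_nat]
  refine ⟨fun i => S.affine _, fun i => ?_, fun i => ?_, fun i => ?_, fun i => S.col _,
    fun i => ?_⟩
  · rw [hs a ha]; exact S.ne _
  · rw [hs a ha]; exact S.row _
  · rw [hs r hr]; exact S.row' _
  · rw [hs a ha]; exact S.diag _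

end Strip
-- Grids: slopes and closing up
/-- A triangular grid of points: the steps `e`, `f` and `f - e` have the directions
`D`, `Q` and `O`. -/
structure Grid (C : β → β → β → Prop) {A : Type*} [AddCommGroup A] (P : A → β) (e f : A)
    (D Q O : β) : Prop where
  dir : Directions C D Q O
  affine : ∀ x, ¬ C D Q (P x)
  ne : ∀ x, P x ≠ P (x + e)
  row : ∀ x, C D (P x) (P (x + e))
  col : ∀ x, C Q (P x) (P (x + f))
  diag : ∀ x, C O (P (x + e)) (P (x + f))

namespace Grid

variable {A : Type*} [AddCommGroup A] {P : A → β} {e f : A} {D Q O : β}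

theorem ne_col (h : IsCollinearity C) (G : Grid C P e f D Q O) (x : A) : P x ≠ P (x + f) := by
  intro H
  have h1 := G.diag x
  rw [← H] at h1
  exact G.ne x (h.eq_of_col (G.dir.affine_do h (G.affine x)) (G.row x) (h.swap_right h1))

theorem swap (h : IsCollinearity C) (G : Grid C P e f D Q O) : Grid C P f e Q D O :=
  ⟨G.dir.swap h, fun x H => G.affine x (h.swap H), G.ne_col h, G.col, G.row,
    fun x => h.swap_right (G.diag x)⟩

theorem row_nsmul (h : IsCollinearity C) (G : Grid C P e f D Q O) (x : A) (k : ℕ) :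
    C D (P x) (P (x + k • e)) := by
  induction k with
  | zero => simpa using h.refl_right _ _
  | succ k ih =>
    have h1 := G.row (x + k • e)
    have := Directions.ne_d h (G.affine (x + k • e))
    rw [succ_nsmul, ← add_assoc]
    grind [h.rot, h.swap, h.trans]

/-- Every parallelogram with steps e and f is a quadrangle on the same triple D, O, Q, so all its
diagonals in direction e + f pass through one point D', the conjugate of O. Since f - (e + f) = -e,
the third direction of the new grid is D. -/
theorem shear (h : IsHarmonicCollinearity C) (G : Grid C P e f D Q O) :
    ∃ D', C D Q D' ∧ Grid C P (e + f) f D' Q D := by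
  have hC := h.toIsCollinearity
  have hcol := G.dir.col
  have hcfg : ∀ x, HarmonicConfig C D O Q (P x) (P (x + e)) (P (x + e + f)) (P (x + f)) := by
    intro x
    have e1 := G.row x
    have e2 := G.row (x + f)
    have e3 := G.col x
    have e4 := G.col (x + e)
    have e5 := G.diag x
    rw [add_right_comm] at e2
    exact
      { yxz := by grind [hC.rot, hC.swap]
        xqs := e5
        yoq := e1
        yrs := by grind [hC.rot, hC.swap]
        zos := e3
        zqr := e4
        nyzq := G.affine _
        xy := G.dir.od
        xz := G.dir.oq
        oy := Directions.ne_d hC (G.affine _)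
        oq := G.ne x }
  obtain ⟨D', hD1, hD2⟩ := h.exists_conj (hcfg 0)
  have hD : ∀ x, C (P x) (P (x + e + f)) D' := fun x => h.conj_col (hcfg 0) hD1 hD2 (hcfg x)
  have e1 := G.row 0
  have e2 := G.col (0 + e)
  have e3 := G.affine 0
  have e4 := G.affine (0 + e)
  have e5 := G.ne 0
  have e6 := G.ne_col hC (0 + e)
  have e7 := hD 0
  have e8 := G.dir.dq
  have n1 := Directions.ne_d hC e3
  have n2 := Directions.ne_q hC e4
  have n3 := Directions.ne_q hC (G.affine (0 + e + f))
  have d1 : D' ≠ D := by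
    rintro rfl
    exact e6 (hC.eq_of_col e4 (hC.join n1.symm e1 (by grind [hC.rot, hC.swap])) e2)
  have d2 : D' ≠ Q := by
    rintro rfl
    have : C D' (P 0) (P (0 + e)) := by grind [hC.rot, hC.swap, hC.trans]
    exact e5 (hC.eq_of_col e3 e1 this)
  refine ⟨D', hD1, ⟨d2, d1.symm, e8, by grind [hC.rot, hC.swap]⟩, fun x => ?_, fun x H => ?_,
    fun x => ?_, G.col, fun x => ?_⟩
  · have := G.affine x
    grind [hC.rot, hC.swap, hC.trans]
  · rw [← add_assoc] at H
    have g1 := G.col (x + e)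
    have g2 := Directions.ne_q hC (G.affine x)
    rw [← H] at g1
    exact G.ne x (hC.eq_of_col (G.affine x) (G.row x) (by grind [hC.rot, hC.swap]))
  · rw [← add_assoc]
    exact hC.rot_right (hD x)
  · have := G.row (x + f)
    rw [add_right_comm] at this
    rw [← add_assoc]
    exact hC.swap_right this

theorem exists_slope (h : IsHarmonicCollinearity C) (G : Grid C P e f D Q O) (t : ℕ) :
    ∃ E O', C D Q E ∧ Grid C P (e + t • f) f E Q O' := by
  have hC := h.toIsCollinearity
  induction t with
  | zero => exact ⟨D, O, hC.rot (hC.refl _ _), by simpa using G⟩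
  | succ t ih =>
    obtain ⟨E, O', hE, G'⟩ := ih
    obtain ⟨E', hE', G''⟩ := G'.shear h
    refine ⟨E', E, ?_, by rwa [succ_nsmul, ← add_assoc]⟩
    have := G'.dir.dq
    grind [hC.rot, hC.swap, hC.trans]

/-- Rows are added one at a time by `Strip.exists_next`; the point is that the row with index n is
the initial row again. -/
theorem exists_of_strip (h : IsHarmonicCollinearity C) (F : Directions C D Q O) {n : ℕ} [NeZero n]
    {a r : ZMod n → β} (S : Strip C D Q O a r) :
    ∃ P : ZMod n × ZMod n → β, Grid C P (1, 0) (0, 1) D Q O ∧ ∀ i, P (i, 0) = a i := by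
  have hC := h.toIsCollinearity
  choose next hnext using fun p : {p : (ZMod n → β) × (ZMod n → β) // Strip C D Q O p.1 p.2} =>
    p.2.exists_next h F
  let rows : ℕ → {p : (ZMod n → β) × (ZMod n → β) // Strip C D Q O p.1 p.2} := fun j =>
    Nat.rec ⟨(a, r), S⟩ (fun _ p => ⟨(p.1.2, next p), hnext p⟩) j
  let R : ℕ → ZMod n → β := fun j => (rows j).1.1
  have hR0 : R 0 = a := rfl
  have hR : ∀ j, Strip C D Q O (R j) (R (j + 1)) := fun j => (rows j).2
  clear_value R
  have hcol : ∀ j i, C Q (a i) (R j i) := by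
    intro j i
    induction j with
    | zero => rw [hR0]; exact hC.refl_right _ _
    | succ j ih =>
      have := (hR j).col i
      have := Directions.ne_q hC ((hR j).affine i)
      grind [hC.rot, hC.swap, hC.trans]
  have hdiag : ∀ (j : ℕ) i, C O (a (i + j)) (R j i) := by
    intro j
    induction j with
    | zero => intro i; rw [hR0]; simpa using hC.refl_right _ _
    | succ j ih =>
      intro i
      have h1 := (hR j).diag i
      have h2 := F.ne_o ((hR j).affine (i + 1))
      have h3 := ih (i + 1)
      rw [add_assoc, add_comm 1] at h3
      push_cast
      grind [hC.rot, hC.swap, hC.trans]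
  -- The point i of row n lies on the Q-line through a i and on the O-line through a (i + n) = a i;
  -- these two lines meet only in a i.
  have hper : R n = R 0 := by
    funext i
    have h1 := hcol n i
    have h2 := hdiag n i
    rw [CharP.cast_eq_zero, add_zero] at h2
    rw [hR0]
    exact (hC.eq_of_col (F.affine_qo hC (S.affine i)) h1 h2).symm
  have hval : ∀ j : ZMod n, R (j + 1).val = R (j.val + 1) := by
    intro j
    have hlt := ZMod.val_lt j
    rcases Nat.lt_or_ge (j.val + 1) n with hj | hj
    · congr 1
      rw [ZMod.val_add, ZMod.val_one_eq_one_mod, Nat.add_mod_mod, Nat.mod_eq_of_lt hj]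
    · have : j.val + 1 = n := by omega
      rw [this, hper]
      congr 1
      rw [ZMod.val_add, ZMod.val_one_eq_one_mod, Nat.add_mod_mod, this, Nat.mod_self]
  refine ⟨fun x => R x.2.val x.1, ⟨F, fun x => (hR _).affine _, fun x => ?_, fun x => ?_,
    fun x => ?_, fun x => ?_⟩, fun i => ?_⟩
  · simpa using (hR _).ne _
  · simpa using (hR _).row _
  · simpa [hval] using (hR _).col _
  · simpa [hval] using (hR _).diag _
  · simp [hR0]

end Grid
-- Coordinates over a prime field
/-- The affine points `P x y` and the points at infinity `Q` and `E t` (for the lines of slope `t`)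
of a plane over the field `K`. -/
structure CoordPlane (C : β → β → β → Prop) {K : Type*} [Field K] (P : K → K → β) (Q : β)
    (E : K → β) : Prop where
  affine : ∀ x y, ¬ C (E 0) Q (P x y)
  infinity : ∀ t, C (E 0) Q (E t)
  col : ∀ x y y', C Q (P x y) (P x y')
  line : ∀ t x y k, C (E t) (P x y) (P (x + k) (y + t * k))
  inj_row : ∀ {x x' y}, P x y = P x' y → x = x'
  inj_col : ∀ {x y y'}, P x y = P x y' → y = y'

namespace Grid

variable {D Q O : β} {n : ℕ} [NeZero n] {P : ZMod n × ZMod n → β}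

/-- Projection in direction O takes P (x, k) to P (x + k, 0), so injectivity on the bottom row
transfers to the columns. -/
theorem injective_col (h : IsCollinearity C) (G : Grid C P (1, 0) (0, 1) D Q O)
    (hP : Function.Injective fun i => P (i, 0)) {x y y' : ZMod n} (H : P (x, y) = P (x, y')) :
    y = y' := by
  have key : ∀ k : ℕ, C O (P (x + k, 0)) (P (x, k)) := by
    have : ∀ k l : ℕ, C O (P (x + k, l)) (P (x, l + k)) := by
      intro k
      induction k with
      | zero => intro l; simpa using h.refl_right _ _
      | succ k ih =>
        intro l
        have h1 := G.diag (x + k, (l : ZMod n))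
        have h2 := ih (l + 1)
        have h3 := G.dir.ne_o (G.affine (x + k, (l : ZMod n) + 1))
        simp only [Prod.mk_add_mk, add_zero] at h1
        push_cast at h2 ⊢
        rw [add_right_comm, add_assoc] at h2
        rw [← add_assoc]
        grind [h.rot, h.swap, h.trans]
    intro k
    simpa using this k 0
  have hrow : ∀ i j : ZMod n, C D (P (i, 0)) (P (j, 0)) := by
    intro i j
    have := G.row_nsmul h (i, 0) (j - i).val
    simpa using this
  have h1 := key y.val
  have h2 := key y'.val
  simp only [ZMod.natCast_val, ZMod.cast_id', id_eq] at h1 h2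
  rw [← H] at h2
  have h3 := G.dir.ne_o (G.affine (x, y))
  have := h.eq_of_col (G.dir.affine_do h (G.affine (x + y, 0))) (hrow (x + y) (x + y'))
    (by grind [h.rot, h.swap, h.trans])
  have := hP this
  simpa using this

theorem col_col (h : IsCollinearity C) (G : Grid C P (1, 0) (0, 1) D Q O) (x y y' : ZMod n) :
    C Q (P (x, y)) (P (x, y')) := by
  have := (G.swap h).row_nsmul h (x, y) (y' - y).val
  simpa using this

theorem row_row (h : IsCollinearity C) (G : Grid C P (1, 0) (0, 1) D Q O) (x x' y : ZMod n) :
    C D (P (x, y)) (P (x', y)) := by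
  have := G.row_nsmul h (x, y) (x' - x).val
  simpa using this

theorem injective_row (h : IsCollinearity C) (G : Grid C P (1, 0) (0, 1) D Q O)
    (hP : Function.Injective fun i => P (i, 0)) {x x' y : ZMod n} (H : P (x, y) = P (x', y)) :
    x = x' := by
  have h1 := G.col_col h x y 0
  have h2 := G.col_col h x' y 0
  rw [← H] at h2
  exact hP (h.eq_of_col (G.affine _) (G.row_row h x x' 0)
    (h.join (Directions.ne_q h (G.affine (x, y))).symm h1 h2))

/-- If n = a * c properly, the line through the origin with step (a, 1) also contains c • (a, 1) =
(0, c), a second point of the column of the origin. It is then that column, so (a, 1) lies in it and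
a = 0 in ℤ/n. -/
theorem prime (h : IsHarmonicCollinearity C) (G : Grid C P (1, 0) (0, 1) D Q O)
    (hP : Function.Injective fun i => P (i, 0)) : n.Prime := by
  have hC := h.toIsCollinearity
  have hn1 : n ≠ 1 := by
    rintro rfl
    exact G.ne 0 (congrArg P (Subsingleton.elim _ _))
  by_contra hnp
  obtain ⟨a, ha, ha1, han⟩ := (Nat.not_prime_iff_exists_dvd_lt
    (by have := NeZero.ne n; omega)).1 hnp
  obtain ⟨c, hc⟩ := ha
  obtain ⟨E, O', -, G'⟩ := (G.swap hC).exists_slope h a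
  have hc0 : 0 < c := Nat.pos_of_ne_zero (by rintro rfl; exact NeZero.ne n (by simpa using hc))
  have hcn : c < n := by nlinarith
  have h1 := G'.row_nsmul hC 0 1
  have h2 := G'.row_nsmul hC 0 c
  have e : c • (((0, 1) : ZMod n × ZMod n) + a • (1, 0)) = (0, (c : ZMod n)) := by
    have : (c : ZMod n) * a = 0 := by
      rw [← Nat.cast_mul, mul_comm, ← hc, CharP.cast_eq_zero]
    simp [this]
  rw [e] at h2
  simp only [one_smul, Prod.smul_mk, nsmul_eq_mul, mul_one, mul_zero, Prod.mk_add_mk, zero_add,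
    add_zero] at h1 h2
  have hne : P 0 ≠ P (0, (c : ZMod n)) := fun H => by
    have h3 : (0 : ZMod n) = c := G.injective_col hC hP (x := 0) H
    have h4 := (ZMod.natCast_eq_zero_iff c n).1 h3.symm
    exact absurd (Nat.le_of_dvd hc0 h4) (by omega)
  have hcol := G.col_col hC 0 0 (c : ZMod n)
  have hcol' := G.col_col hC 0 0 1
  have hE := Directions.ne_d hC (G'.affine 0)
  have hQ := Directions.ne_q hC (G.affine 0)
  have h5 : C Q (P 0) (P ((a : ZMod n), 1)) := by
    change C Q (P 0) (P (0, (c : ZMod n))) at hcol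
    grind [hC.rot, hC.swap, hC.trans]
  have h6 := hC.join hQ.symm hcol' h5
  have h7 := hC.eq_of_col (G.affine _) (G.row_row hC 0 (a : ZMod n) 1) h6
  have h8 := (ZMod.natCast_eq_zero_iff a n).1 (G.injective_row hC hP h7).symm
  exact absurd (Nat.le_of_dvd (by omega) h8) (by omega)

theorem exists_coordPlane (h : IsHarmonicCollinearity C) [Fact n.Prime]
    (G : Grid C P (1, 0) (0, 1) D Q O) (hP : Function.Injective fun i => P (i, 0)) :
    ∃ E : ZMod n → β, E 0 = D ∧ CoordPlane C (fun x y => P (x, y)) Q E := by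
  have hC := h.toIsCollinearity
  have key : ∀ t : ZMod n, ∃ E, (t = 0 → E = D) ∧ C D Q E ∧
      ∀ x y k, C E (P (x, y)) (P (x + k, y + t * k)) := by
    intro t
    by_cases ht : t = 0
    -- `exists_slope` does not reveal which point it returns for slope 0, so D is supplied directly.
    · subst ht
      exact ⟨D, fun _ => rfl, hC.rot (hC.refl _ _), fun x y k => by simpa using G.row_row hC _ _ _⟩
    · obtain ⟨E, O', hE, G'⟩ := G.exists_slope h t.val
      refine ⟨E, fun h => absurd h ht, hE, fun x y k => ?_⟩
      have := G'.row_nsmul hC (x, y) k.val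
      simpa [mul_comm] using this
  choose E hE0 hE1 hE2 using key
  refine ⟨E, hE0 0 rfl, ?_⟩
  rw [← hE0 0 rfl] at G hE1
  exact ⟨fun x y => G.affine _, hE1, G.col_col hC, fun t x y k => hE2 t x y k,
    G.injective_row hC hP, G.injective_col hC hP⟩

end Grid

namespace HarmonicConfig

/-- Interchanging y and z interchanges q and s; o and r stay, hence so does the line that cuts out
the conjugate. -/
theorem symm (h : IsCollinearity C) {y x z o q r s : β} (H : HarmonicConfig C y x z o q r s) :
    HarmonicConfig C z x y o s r q := by
  obtain ⟨h1, h2, h3, h4, h5, h6, h7, h8, h9, h10, h11⟩ := H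
  refine ⟨?_, ?_, ?_, ?_, ?_, ?_, ?_, h9, h8, ?_, ?_⟩ <;> grind [h.rot, h.swap, h.trans, h.refl]

end HarmonicConfig

theorem HarmonicConj.symm (h : IsCollinearity C) {y z x x' : β} (H : HarmonicConj C y z x x') :
    HarmonicConj C z y x x' := by
  obtain ⟨o, q, r, s, H, h1, h2⟩ := H
  exact ⟨o, s, r, q, H.symm h, h.swap h1, h2⟩

theorem IsCollinearity.col_of_join (h : IsCollinearity C) {d a b c : β} (hd : d ≠ a) (h1 : C d a b)
    (h2 : C d a c) : C a b c := h.trans hd.symm (h.swap h1) (h.swap h2)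

namespace CoordPlane

variable {K : Type*} [Field K] {P : K → K → β} {Q : β} {E : K → β}

theorem line' (H : CoordPlane C P Q E) (t x y x' y' : K) (e : y' = y + t * (x' - x)) :
    C (E t) (P x y) (P x' y') := by
  have := H.line t x y (x' - x)
  rwa [add_sub_cancel, ← e] at this

theorem row (H : CoordPlane C P Q E) (x x' y : K) : C (E 0) (P x y) (P x' y) :=
  H.line' 0 x y x' y (by ring)

theorem slope_ne (h : IsCollinearity C) (H : CoordPlane C P Q E) (t : K) : E t ≠ Q := by
  intro e
  have h1 := H.line' t 0 0 1 t (by ring)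
  have h2 := H.col 1 t 0
  have h3 := H.row 0 1 0
  have h4 := Directions.ne_q h (H.affine 1 t)
  rw [e] at h1
  exact zero_ne_one (H.inj_row (h.eq_of_col (H.affine 0 0) h3
    (by grind [h.rot, h.swap, h.trans])))

theorem slope_one_ne (h : IsCollinearity C) (H : CoordPlane C P Q E) : E 1 ≠ E 0 := by
  intro e
  have h1 := H.line' 1 0 0 1 1 (by ring)
  have h2 := H.col 1 1 0
  have h3 := H.row 0 1 0
  have h4 := Directions.ne_d h (H.affine 0 0)
  rw [e] at h1
  exact one_ne_zero (H.inj_col (h.eq_of_col (H.affine 1 1)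
    (by grind [h.rot, h.swap, h.trans]) h2))

theorem affine_slope (h : IsCollinearity C) (H : CoordPlane C P Q E) (t x y : K) :
    ¬ C (E t) Q (P x y) := by
  have h1 := H.infinity t
  have h2 := H.affine x y
  have h3 := H.slope_ne h t
  grind [h.rot, h.swap, h.trans]

theorem dir_ne (h : IsCollinearity C) (H : CoordPlane C P Q E) (t x y : K) : E t ≠ P x y :=
  (Directions.ne_d h (H.affine_slope h t x y)).symm

/-- A point of the line `y = 0` on the line of slope `t` through `P x y`. -/
theorem exists_axis (h : IsCollinearity C) (H : CoordPlane C P Q E) {x y x' y' t : K}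
    (e : y' = y + t * (x' - x)) : ∃ w ∈ insert (E 0) (Set.range fun i => P i 0),
      C (P x y) (P x' y') w := by
  by_cases ht : t = 0
  · subst ht
    exact ⟨E 0, Set.mem_insert _ _, h.rot (H.line' 0 _ _ _ _ e)⟩
  · refine ⟨P (x - y / t) 0, Or.inr ⟨_, rfl⟩, ?_⟩
    exact h.col_of_join (H.dir_ne h t x y) (H.line' t _ _ _ _ e)
      (H.line' t _ _ _ _ (by field_simp; ring))

theorem axis_col (h : IsCollinearity C) (H : CoordPlane C P Q E) {u v w : β}
    (hu : u ∈ insert (E 0) (Set.range fun i => P i 0))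
    (hv : v ∈ insert (E 0) (Set.range fun i => P i 0))
    (hw : w ∈ insert (E 0) (Set.range fun i => P i 0)) : C u v w := by
  have h1 : ∀ {u}, u ∈ insert (E 0) (Set.range fun i => P i 0) → C (E 0) (P 0 0) u := by
    rintro u (rfl | ⟨i, rfl⟩)
    · exact h.rot (h.refl _ _)
    · exact H.row _ _ _
  have h2 := h1 hu
  have h3 := h1 hv
  have h4 := h1 hw
  have h5 := H.dir_ne h 0 0 0
  by_cases h6 : u = E 0
  · subst h6; exact h.join h5 h3 h4
  · grind [h.rot, h.swap, h.trans, h.refl]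

/-- Harmonic conjugation on the line `y = 0`. -/
theorem exists_harmonicConj (h : IsCollinearity C) (H : CoordPlane C P Q E) {y x z : β}
    (hy : y ∈ insert (E 0) (Set.range fun i => P i 0))
    (hx : x ∈ insert (E 0) (Set.range fun i => P i 0))
    (hz : z ∈ insert (E 0) (Set.range fun i => P i 0)) (hxy : x ≠ y) (hxz : x ≠ z) (hyz : y ≠ z) :
    ∃ w ∈ insert (E 0) (Set.range fun i => P i 0), HarmonicConj C y z x w := by
  have aff : ∀ i j : K, i ≠ j → ¬ C (P i 0) (P j 0) Q := fun i j hij => by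
    have h1 := H.row i j 0
    have h2 := H.affine i 0
    intro h3
    exact hij (H.inj_row (h.eq_of_col h2 h1 (h.rot_right h3)))
  -- With E 0 as one of the two base points, conjugation is the reflection of i in j.
  have conj_inf : ∀ j i : K, i ≠ j → ∃ w ∈ insert (E 0) (Set.range fun i => P i 0),
      HarmonicConj C (E 0) (P j 0) (P i 0) w := by
    intro j i hij
    refine ⟨P (j - (i - j)) 0, Or.inr ⟨_, rfl⟩, E 1, Q, P j (i - j), P i (i - j), ?_, H.row _ _ _,
      H.line' 1 _ _ _ _ (by ring)⟩
    exact
      { yxz := H.row _ _ _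
        xqs := h.swap (H.col _ _ _)
        yoq := h.swap_right (H.infinity _)
        yrs := H.row _ _ _
        zos := h.swap (H.line' 1 _ _ _ _ (by ring))
        zqr := h.swap (H.col _ _ _)
        nyzq := fun h1 => H.affine j 0 (h.swap_right h1)
        xy := (H.dir_ne h _ _ _).symm
        xz := fun e => hij (H.inj_row e)
        oy := H.slope_one_ne h
        oq := H.slope_ne h 1 }
  rcases hy with rfl | ⟨i, rfl⟩
  · obtain rfl | ⟨i, rfl⟩ := hx
    · exact absurd rfl hxy
    obtain rfl | ⟨j, rfl⟩ := hz
    · exact absurd rfl hyz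
    exact conj_inf j i fun e => hxz (by rw [e])
  rcases hz with rfl | ⟨j, rfl⟩
  · obtain rfl | ⟨k, rfl⟩ := hx
    · exact absurd rfl hxz
    obtain ⟨w, hw, hw'⟩ := conj_inf i k fun e => hxy (by rw [e])
    exact ⟨w, hw, hw'.symm h⟩
  have hij : i ≠ j := fun e => hyz (by rw [e])
  have hij' : i - j ≠ 0 := sub_ne_zero.2 hij
  have hoy : P i (i - j) ≠ P i 0 := fun e => hij' (H.inj_col e)
  rcases hx with rfl | ⟨k, rfl⟩
  -- The conjugate of the point at infinity is the midpoint of i and j. In characteristic two the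
  -- slope 2 vanishes and the conjugate is E 0 itself; `exists_axis` covers both cases.
  · obtain ⟨w, hw, hw2⟩ := H.exists_axis h (x := i) (y := i - j) (x' := j) (y' := j - i)
      (t := 2) (by ring)
    refine ⟨w, hw, P i (i - j), Q, P j (j - i), E 1, ?_,
      H.axis_col h (Or.inr ⟨_, rfl⟩) (Or.inr ⟨_, rfl⟩) hw, hw2⟩
    exact
      { yxz := h.swap (H.row _ _ _)
        xqs := H.infinity _
        yoq := h.rot (H.col _ _ _)
        yrs := h.rot (H.line' 1 _ _ _ _ (by ring))
        zos := h.rot (H.line' 1 _ _ _ _ (by ring))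
        zqr := h.swap (H.col _ _ _)
        nyzq := aff i j hij
        xy := H.dir_ne h _ _ _
        xz := H.dir_ne h _ _ _
        oy := hoy
        oq := Directions.ne_q h (H.affine _ _) }
  · have hki : k - i ≠ 0 := sub_ne_zero.2 fun e => hxy (by rw [e])
    -- The quadrangle has q = Q vertical and o, s on the line of slope 1 through (j, 0), above i and
    -- k; r is where the line from (i, 0) to s, of slope (k-j)/(k-i), crosses the column of j. If k
    -- is a midpoint, the line or has slope 0 and w = E 0.
    obtain ⟨w, hw, hw2⟩ := H.exists_axis h (x := i) (y := i - j) (x' := j)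
      (y' := (k - j) / (k - i) * (j - i)) (t := 1 + (k - j) / (k - i)) (by ring)
    refine ⟨w, hw, P i (i - j), Q, P j ((k - j) / (k - i) * (j - i)), P k (k - j), ?_,
      H.axis_col h (Or.inr ⟨_, rfl⟩) (Or.inr ⟨_, rfl⟩) hw, hw2⟩
    exact
      { yxz := H.axis_col h (Or.inr ⟨_, rfl⟩) (Or.inr ⟨_, rfl⟩) (Or.inr ⟨_, rfl⟩)
        xqs := h.swap (H.col _ _ _)
        yoq := h.rot (H.col _ _ _)
        yrs := h.col_of_join (H.dir_ne h ((k - j) / (k - i)) _ _) (H.line' _ _ _ _ _ (by ring))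
          (H.line' _ _ _ _ _ (by field_simp; ring))
        zos := h.col_of_join (H.dir_ne h 1 _ _) (H.line' _ _ _ _ _ (by ring))
          (H.line' _ _ _ _ _ (by ring))
        zqr := h.swap (H.col _ _ _)
        nyzq := aff i j hij
        xy := hxy
        xz := hxz
        oy := hoy
        oq := Directions.ne_q h (H.affine _ _) }

end CoordPlane

/-- The points of a conjugate sequence whose first repetition is `b n` are closed under harmonic
conjugation. -/
theorem exists_conj_of_first_repeat (h : IsHarmonicCollinearity C) {D : β} {b : ℕ → β}
    (hb : ∀ i, HarmonicConj C D (b (i + 1)) (b i) (b (i + 1 + 1))) {m n : ℕ} (hmn : m < n)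
    (H : b n = b m) (hn : ∀ k < n, ∀ l < k, b k ≠ b l) :
    Function.Periodic b n ∧ ∀ y ∈ insert D (Set.range b), ∀ x ∈ insert D (Set.range b),
      ∀ z ∈ insert D (Set.range b), x ≠ y → x ≠ z → y ≠ z →
        ∃ w ∈ insert D (Set.range b), HarmonicConj C y z x w := by
  have hC := h.toIsCollinearity
  obtain ⟨Q, O, r, F, S⟩ := exists_strip h hb
  have h0 := S.eq_zero_of_first_repeat hC F hmn H hn
  have hp := S.periodic hC F h0
  have : NeZero n := ⟨by omega⟩
  obtain ⟨P, G, hP⟩ := Grid.exists_of_strip h F (S.zmod hp (S.periodic' hC F h0))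
  have hinj : Function.Injective fun i => P (i, 0) := by
    intro i j hij
    simp only [hP] at hij
    have hi := ZMod.val_lt i
    have hj := ZMod.val_lt j
    apply ZMod.val_injective
    by_contra hne
    rcases lt_or_gt_of_ne hne with hlt | hlt
    · exact hn _ hj _ hlt hij.symm
    · exact hn _ hi _ hlt hij
  have : Fact n.Prime := ⟨G.prime h hinj⟩
  obtain ⟨E, rfl, hE⟩ := G.exists_coordPlane h hinj
  have hrange : Set.range b = Set.range fun i => P (i, 0) := by
    ext w
    constructor
    · rintro ⟨k, rfl⟩
      exact ⟨k, by simp only [hP, ZMod.val_natCast, hp.map_mod_nat]⟩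
    · rintro ⟨i, rfl⟩
      exact ⟨i.val, (hP i).symm⟩
  refine ⟨hp, fun y hy x hx z hz => ?_⟩
  rw [hrange] at hy hx hz ⊢
  exact hE.exists_harmonicConj hC hy hx hz

end Geometry

/-! ### Nondegeneracy of configurations and the points of a matroid -/

section Geometry
variable {β : Type*} {C : β → β → β → Prop}

/-- Apart from its six lines and possibly `xor`, no three points of a harmonic configuration are
collinear. -/
theorem HarmonicConfig.not_col (h : IsCollinearity C) {y x z o q r s : β}
    (H : HarmonicConfig C y x z o q r s) :
    ¬ C y x o ∧ ¬ C y x q ∧ ¬ C y x r ∧ ¬ C y x s ∧ ¬ C y z o ∧ ¬ C y z q ∧ ¬ C y z r ∧ ¬ C y z s ∧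
    ¬ C y o r ∧ ¬ C y o s ∧ ¬ C y q r ∧ ¬ C y q s ∧ ¬ C x z o ∧ ¬ C x z q ∧ ¬ C x z r ∧ ¬ C x z s ∧
    ¬ C x o q ∧ ¬ C x o s ∧ ¬ C x q r ∧ ¬ C x r s ∧ ¬ C z o q ∧ ¬ C z o r ∧ ¬ C z q s ∧ ¬ C z r s ∧
    ¬ C o q r ∧ ¬ C o q s ∧ ¬ C o r s ∧ ¬ C q r s := by
  obtain ⟨h1, h2, h3, h4, h5, h6, h7, h8, h9, h10, h11⟩ := H
  have a1 : ¬ C x z q := by grind [h.rot, h.swap, h.trans, h.refl]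
  have a2 : ¬ C y x q := by grind [h.rot, h.swap, h.trans, h.refl]
  have a3 : ¬ C y z o := by grind [h.rot, h.swap, h.trans, h.refl]
  have a4 : ¬ C z o q := by grind [h.rot, h.swap, h.trans, h.refl]
  have a5 : ¬ C x z o := by grind [h.rot, h.swap, h.trans, h.refl]
  have a6 : ¬ C y x o := by grind [h.rot, h.swap, h.trans, h.refl]
  have a7 : ¬ C x o q := by grind [h.rot, h.swap, h.trans, h.refl]
  have b1 : s ≠ q := by grind [h.rot, h.swap, h.trans, h.refl]
  have b2 : s ≠ x := by grind [h.rot, h.swap, h.trans, h.refl]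
  have b3 : s ≠ z := by grind [h.rot, h.swap, h.trans, h.refl]
  have b4 : s ≠ o := by grind [h.rot, h.swap, h.trans, h.refl]
  have a8 : ¬ C y z s := by grind [h.rot, h.swap, h.trans, h.refl]
  have a9 : ¬ C y x s := by grind [h.rot, h.swap, h.trans, h.refl]
  have a10 : ¬ C x z s := by grind [h.rot, h.swap, h.trans, h.refl]
  have a11 : ¬ C y o s := by grind [h.rot, h.swap, h.trans, h.refl]
  have a12 : ¬ C y q s := by grind [h.rot, h.swap, h.trans, h.refl]
  have a13 : ¬ C x o s := by grind [h.rot, h.swap, h.trans, h.refl]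
  have a14 : ¬ C z q s := by grind [h.rot, h.swap, h.trans, h.refl]
  have a15 : ¬ C o q s := by grind [h.rot, h.swap, h.trans, h.refl]
  have c1 : r ≠ y := by grind [h.rot, h.swap, h.trans, h.refl]
  have c2 : r ≠ s := by grind [h.rot, h.swap, h.trans, h.refl]
  have c3 : r ≠ z := by grind [h.rot, h.swap, h.trans, h.refl]
  have c4 : r ≠ q := by grind [h.rot, h.swap, h.trans, h.refl]
  refine ⟨a6, a2, ?_, a9, a3, h7, ?_, a8, ?_, a11, ?_, a12, a5, a1, ?_, a10, a7, a13, ?_, ?_, a4,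
    ?_, a14, ?_, ?_, a15, ?_, ?_⟩ <;> grind [h.rot, h.swap, h.trans, h.refl]

theorem HarmonicConfig.left_ne_right (h : IsCollinearity C) {y x z o q r s : β}
    (H : HarmonicConfig C y x z o q r s) : y ≠ z := by
  rintro rfl
  exact H.nyzq (h.refl _ _)

theorem HarmonicConfig.quadrangle_ne (h : IsCollinearity C) {y x z o q r s : β}
    (H : HarmonicConfig C y x z o q r s) : o ≠ r := by
  rintro rfl
  exact (H.not_col h).2.2.2.2.2.2.2.2.1 (h.refl_right _ _)

/-- The listed sets are the 28 bases of the Fano matroid, namely the 35 triples without the seven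
lines. Independence in M then needs checking only on these, which are the triples in
`HarmonicConfig.not_col`. -/
theorem exists_fano_triple_superset : ∀ I : Finset (Fin 7), I.card ≤ 3 → I ∉ fanoLines →
    ∃ T ∈ ({{0, 1, 3}, {0, 1, 4}, {0, 1, 5}, {0, 1, 6}, {0, 2, 3}, {0, 2, 4}, {0, 2, 5},
      {0, 2, 6}, {0, 3, 5}, {0, 3, 6}, {0, 4, 5}, {0, 4, 6}, {1, 2, 3}, {1, 2, 4}, {1, 2, 5},
      {1, 2, 6}, {1, 3, 4}, {1, 3, 6}, {1, 4, 5}, {1, 5, 6}, {2, 3, 4}, {2, 3, 5}, {2, 4, 6},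
      {2, 5, 6}, {3, 4, 5}, {3, 4, 6}, {3, 5, 6}, {4, 5, 6}} : Finset (Finset (Fin 7))), I ⊆ T := by
  decide +kernel

theorem sevenPointMatroid_indep_iff (L : Finset (Finset (Fin 7))) (h3 : ∀ l ∈ L, l.card = 3)
    (hL : ∀ l ∈ L, ∀ l' ∈ L, l ≠ l' → (l ∩ l').card ≤ 1) (I : Finset (Fin 7)) :
    (sevenPointMatroid L h3 hL).Indep I ↔ I.card ≤ 3 ∧ I ∉ L := by
  simp only [sevenPointMatroid, IndepMatroid.matroid_Indep, IndepMatroid.ofFinset_indep]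

namespace Matroid

variable {α : Type*} {M : Matroid α}

theorem eRk_pair_le (M : Matroid α) (a b : α) : M.eRk {a, b} ≤ 2 := by
  refine (M.eRk_le_encard _).trans ((Set.encard_insert_le _ _).trans ?_)
  rw [Set.encard_singleton]
  norm_num

theorem encard_triple_le (a b c : α) : ({a, b, c} : Set α).encard ≤ 3 := by
  refine (Set.encard_insert_le _ _).trans ?_
  calc ({b, c} : Set α).encard + 1 ≤ (1 + 1) + 1 := by
        gcongr
        exact (Set.encard_insert_le _ _).trans (by rw [Set.encard_singleton])
      _ = 3 := by norm_num

theorem eRk_triple_eq {a b c : α} (h : ¬ M.eRk {a, b, c} ≤ 2) : M.eRk {a, b, c} = 3 := by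
  refine le_antisymm ((M.eRk_le_encard _).trans (encard_triple_le a b c)) ?_
  have := Order.add_one_le_of_lt (not_le.1 h)
  rwa [show (2 : ℕ∞) + 1 = 3 by norm_num] at this

theorem indep_triple {a b c : α} (h : ¬ M.eRk {a, b, c} ≤ 2) : M.Indep {a, b, c} := by
  rw [indep_iff_eRk_eq_encard_of_finite (by simp)]
  refine le_antisymm (M.eRk_le_encard _) ?_
  rw [eRk_triple_eq h]
  exact encard_triple_le a b c

theorem eRk_triple_le_iff {a b c : α} (hab : M.Indep {a, b}) (hne : a ≠ b) (hc : c ∈ M.E) :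
    M.eRk {a, b, c} ≤ 2 ↔ c ∈ M.closure {a, b} := by
  have hE := hab.subset_ground
  constructor
  · intro h
    by_contra hcl
    have h1 := (hab.notMem_closure_iff hc).1 hcl
    have h2 := h1.1.eRk_eq_encard
    have h3 : (insert c {a, b} : Set α) = {a, b, c} := by
      ext; simp; tauto
    rw [Set.encard_insert_of_notMem h1.2, Set.encard_pair hne, h3] at h2
    rw [h2] at h
    exact absurd h (by norm_num)
  · intro h
    have : ({a, b, c} : Set α) ⊆ M.closure {a, b} := by
      have := M.subset_closure {a, b} hE
      rintro x (rfl | rfl | rfl)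
      exacts [this (by simp), this (by simp), h]
    exact (M.eRk_mono this).trans (by rw [eRk_closure_eq]; exact M.eRk_pair_le a b)

/-- The points of `M`: the closures of single elements. -/
def Point (M : Matroid α) : Type _ := {F : Set α // ∃ e ∈ M.E, F = M.closure {e}}

/-- The point of an element. -/
def point (M : Matroid α) (e : α) (he : e ∈ M.E) : M.Point := ⟨M.closure {e}, e, he, rfl⟩

/-- Collinearity of points. -/
def PointCol (M : Matroid α) (A B C : M.Point) : Prop := M.eRk (A.1 ∪ B.1 ∪ C.1) ≤ 2

theorem Point.exists_eq (A : M.Point) : ∃ e he, A = M.point e he := by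
  obtain ⟨F, e, he, rfl⟩ := A
  exact ⟨e, he, rfl⟩

theorem point_eq_iff {a b : α} {ha : a ∈ M.E} {hb : b ∈ M.E} :
    M.point a ha = M.point b hb ↔ M.closure {a} = M.closure {b} := Subtype.ext_iff

theorem pointCol_iff {a b c : α} {ha : a ∈ M.E} {hb : b ∈ M.E} {hc : c ∈ M.E} :
    M.PointCol (M.point a ha) (M.point b hb) (M.point c hc) ↔ M.eRk {a, b, c} ≤ 2 := by
  have : ({a, b, c} : Set α) = {a} ∪ {b} ∪ {c} := by
    ext; simp; tauto
  rw [PointCol, point, point, point, this, eRk_union_closure_right_eq, Set.union_assoc,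
    eRk_union_closure_left_eq, Set.union_comm {a}, Set.union_assoc, eRk_union_closure_left_eq]
  congr! 2
  ext; simp; tauto

theorem indep_pair_of_point_ne [M.Loopless] {a b : α} {ha : a ∈ M.E} {hb : b ∈ M.E}
    (h : M.point a ha ≠ M.point b hb) : M.Indep {a, b} ∧ a ≠ b := by
  rw [Ne, point_eq_iff, (M.isNonloop_of_loopless ha).closure_eq_closure_iff_eq_or_dep
    (M.isNonloop_of_loopless hb)] at h
  push Not at h
  exact ⟨h.2, h.1⟩

theorem point_ne_of_indep_pair [M.Loopless] {a b : α} {ha : a ∈ M.E} {hb : b ∈ M.E}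
    (h : M.Indep {a, b}) (hne : a ≠ b) : M.point a ha ≠ M.point b hb := by
  rw [Ne, point_eq_iff, (M.isNonloop_of_loopless ha).closure_eq_closure_iff_eq_or_dep
    (M.isNonloop_of_loopless hb)]
  push Not
  exact ⟨hne, h⟩

theorem pointCol_iff_mem_closure [M.Loopless] {a b c : α} {ha : a ∈ M.E} {hb : b ∈ M.E}
    {hc : c ∈ M.E} (h : M.point a ha ≠ M.point b hb) :
    M.PointCol (M.point a ha) (M.point b hb) (M.point c hc) ↔ c ∈ M.closure {a, b} := by
  obtain ⟨h1, h2⟩ := indep_pair_of_point_ne h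
  rw [pointCol_iff, eRk_triple_le_iff h1 h2 hc]

theorem isCollinearity_pointCol [M.Loopless] : IsCollinearity M.PointCol where
  refl A B := by
    obtain ⟨a, ha, rfl⟩ := A.exists_eq
    obtain ⟨b, hb, rfl⟩ := B.exists_eq
    rw [pointCol_iff, Set.insert_eq_of_mem (by simp)]
    exact M.eRk_pair_le a b
  rot {A B C} h := by rwa [PointCol, Set.union_comm, ← Set.union_assoc]
  swap {A B C} h := by rwa [PointCol, Set.union_comm B.1]
  trans {A B C E} hAB h1 h2 := by
    obtain ⟨a, ha, rfl⟩ := A.exists_eq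
    obtain ⟨b, hb, rfl⟩ := B.exists_eq
    obtain ⟨c, hc, rfl⟩ := C.exists_eq
    obtain ⟨e, he, rfl⟩ := E.exists_eq
    rw [pointCol_iff_mem_closure hAB] at h1 h2
    rw [pointCol_iff]
    have : ({a, c, e} : Set α) ⊆ M.closure {a, b} := by
      rintro x (rfl | rfl | rfl)
      exacts [M.mem_closure_of_mem (by simp) (Set.pair_subset ha hb), h1, h2]
    exact (M.eRk_mono this).trans (by rw [eRk_closure_eq]; exact M.eRk_pair_le a b)

end Matroid
end Geometry

/-! ### Harmonic matroids as harmonic collinearity relations -/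

namespace Matroid

variable {α : Type*} {M : Matroid α}

theorem isHP_indep_iff {y x z o q r s : α} (H : M.IsHP y x z o q r s) :
    ∃ L, (L = fanoLines ∨ L = nonFanoLines) ∧ ∀ I : Finset (Fin 7),
      M.Indep (![y, x, z, o, q, r, s] '' I) ↔ I.card ≤ 3 ∧ I ∉ L := by
  obtain ⟨hinj, hE, h | h⟩ := H
  · refine ⟨_, Or.inl rfl, fun I => ?_⟩
    have h1 : ((M ↾ Set.range ![y, x, z, o, q, r, s]).comap ![y, x, z, o, q, r, s]).Indep I ↔
        I.card ≤ 3 ∧ I ∉ fanoLines := by rw [h]; exact sevenPointMatroid_indep_iff _ _ _ I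
    rw [← h1, comap_indep_iff, restrict_indep_iff, and_iff_left (Set.image_subset_range _ _),
      and_iff_left hinj.injOn]
  · refine ⟨_, Or.inr rfl, fun I => ?_⟩
    have h1 : ((M ↾ Set.range ![y, x, z, o, q, r, s]).comap ![y, x, z, o, q, r, s]).Indep I ↔
        I.card ≤ 3 ∧ I ∉ nonFanoLines := by rw [h]; exact sevenPointMatroid_indep_iff _ _ _ I
    rw [← h1, comap_indep_iff, restrict_indep_iff, and_iff_left (Set.image_subset_range _ _),
      and_iff_left hinj.injOn]

theorem IsHP.mem_ground {y x z o q r s : α} (H : M.IsHP y x z o q r s) :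
    (y ∈ M.E ∧ x ∈ M.E ∧ z ∈ M.E) ∧ o ∈ M.E ∧ q ∈ M.E ∧ r ∈ M.E ∧ s ∈ M.E := by
  have h := fun i => H.2.1 (Set.mem_range_self i)
  exact ⟨⟨h 0, h 1, h 2⟩, h 3, h 4, h 5, h 6⟩

theorem IsHP.harmonicConfig [M.Loopless] {y x z o q r s : α} (H : M.IsHP y x z o q r s)
    (hy : y ∈ M.E) (hx : x ∈ M.E) (hz : z ∈ M.E) (ho : o ∈ M.E) (hq : q ∈ M.E) (hr : r ∈ M.E)
    (hs : s ∈ M.E) :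
    HarmonicConfig M.PointCol (M.point y hy) (M.point x hx) (M.point z hz) (M.point o ho)
      (M.point q hq) (M.point r hr) (M.point s hs) := by
  obtain ⟨L, hL, hI⟩ := isHP_indep_iff H
  have hinj := H.1
  have dep : ∀ i j k : Fin 7, {i, j, k} ∈ nonFanoLines →
      M.eRk {![y, x, z, o, q, r, s] i, ![y, x, z, o, q, r, s] j, ![y, x, z, o, q, r, s] k} ≤ 2 := by
    intro i j k h
    by_contra hc
    have h1 := indep_triple hc
    have h2 := (hI {i, j, k}).1 (by simpa [Set.image_insert_eq] using h1)
    rcases hL with rfl | rfl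
    · exact h2.2 (Finset.mem_insert_of_mem h)
    · exact h2.2 h
  have pair : ∀ i j : Fin 7, i ≠ j → ({i, j} : Finset (Fin 7)) ∉ fanoLines →
      M.Indep {![y, x, z, o, q, r, s] i, ![y, x, z, o, q, r, s] j} := by
    intro i j hij h
    have h2 := (hI {i, j}).2 ⟨(Finset.card_le_two).trans (by norm_num), by
      rcases hL with rfl | rfl
      · exact h
      · exact fun h' => h (Finset.mem_insert_of_mem h')⟩
    simpa [Set.image_insert_eq] using h2
  have ne : ∀ i j : Fin 7, i ≠ j → ![y, x, z, o, q, r, s] i ≠ ![y, x, z, o, q, r, s] j :=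
    fun i j hij => hinj.ne hij
  exact
    { yxz := pointCol_iff.2 (dep 0 1 2 (by decide))
      xqs := pointCol_iff.2 (dep 1 4 6 (by decide))
      yoq := pointCol_iff.2 (dep 0 3 4 (by decide))
      yrs := pointCol_iff.2 (dep 0 5 6 (by decide))
      zos := pointCol_iff.2 (dep 2 3 6 (by decide))
      zqr := pointCol_iff.2 (dep 2 4 5 (by decide))
      nyzq := by
        rw [pointCol_iff]
        have h2 := (hI {0, 2, 4}).2 ⟨by decide, by rcases hL with rfl | rfl <;> decide⟩
        have h3 : M.Indep {y, z, q} := by simpa [Set.image_insert_eq] using h2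
        rw [h3.eRk_eq_encard]
        have h02 : y ≠ z := ne 0 2 (by decide)
        have h04 : y ≠ q := ne 0 4 (by decide)
        have h24 : z ≠ q := ne 2 4 (by decide)
        rw [Set.encard_insert_of_notMem (by simp [h02, h04]), Set.encard_pair h24]
        norm_num
      xy := point_ne_of_indep_pair (pair 1 0 (by decide) (by decide)) (ne 1 0 (by decide))
      xz := point_ne_of_indep_pair (pair 1 2 (by decide) (by decide)) (ne 1 2 (by decide))
      oy := point_ne_of_indep_pair (pair 3 0 (by decide) (by decide)) (ne 3 0 (by decide))
      oq := point_ne_of_indep_pair (pair 3 4 (by decide) (by decide)) (ne 3 4 (by decide)) }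

-- The configuration determines the restriction up to one triple: y, z, q span all seven elements,
-- the six lines are dependent, and all other triples except xor are independent. Whether x, o, r
-- are collinear decides between Fano and non-Fano.
set_option maxRecDepth 8000 in
theorem isHP_of_harmonicConfig [M.Loopless] {y x z o q r s : α}
    {hy : y ∈ M.E} {hx : x ∈ M.E} {hz : z ∈ M.E} {ho : o ∈ M.E} {hq : q ∈ M.E} {hr : r ∈ M.E}
    {hs : s ∈ M.E}
    (H : HarmonicConfig M.PointCol (M.point y hy) (M.point x hx) (M.point z hz) (M.point o ho)
      (M.point q hq) (M.point r hr) (M.point s hs)) : M.IsHP y x z o q r s := by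
  set f := ![y, x, z, o, q, r, s] with hf
  have hC := isCollinearity_pointCol (M := M)
  have hrange : Set.range f ⊆ M.E := by
    rintro _ ⟨i, rfl⟩
    fin_cases i <;> assumption
  have hT : ∀ i j k : Fin 7, ¬ M.eRk {f i, f j, f k} ≤ 2 →
      M.eRk (f '' ({i, j, k} : Finset (Fin 7))) = 3 := by
    intro i j k h
    simpa [Set.image_insert_eq] using eRk_triple_eq h
  have hD : ∀ i j k : Fin 7, ({i, j, k} : Finset (Fin 7)).card = 3 → M.eRk {f i, f j, f k} ≤ 2 →
      ¬ (M.Indep (f '' ({i, j, k} : Finset (Fin 7))) ∧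
        Set.InjOn f ({i, j, k} : Finset (Fin 7))) := by
    rintro i j k hc h ⟨h1, h2⟩
    have h3 := h1.eRk_eq_encard
    rw [h2.encard_image, Set.encard_coe_eq_coe_finsetCard, hc] at h3
    simp only [Finset.coe_insert, Finset.coe_singleton, Set.image_insert_eq,
      Set.image_singleton] at h3
    rw [h3] at h
    exact absurd h (by norm_num)
  have rank : M.eRk (Set.range f) ≤ 3 := by
    have hyz : M.point y hy ≠ M.point z hz := fun e => H.nyzq (by rw [e]; exact hC.refl _ _)
    have hyq : M.point y hy ≠ M.point q hq := fun e => H.nyzq (by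
      rw [e]; exact hC.rot (hC.refl _ _))
    have hzq : M.point z hz ≠ M.point q hq := fun e => H.nyzq (by
      rw [e]; exact hC.refl_right _ _)
    have hxq : M.point x hx ≠ M.point q hq := fun e => H.nyzq (by
      rw [← e]; exact hC.swap_right H.yxz)
    have hsub : ({y, z, q} : Set α) ⊆ M.E := by
      rintro _ (rfl | rfl | rfl) <;> assumption
    have cl := M.subset_closure {y, z, q} hsub
    have c0 : y ∈ M.closure {y, z, q} := cl (by simp)
    have c2 : z ∈ M.closure {y, z, q} := cl (by simp)
    have c4 : q ∈ M.closure {y, z, q} := cl (by simp)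
    have step : ∀ {a b c : α} {ha : a ∈ M.E} {hb : b ∈ M.E} {hc : c ∈ M.E},
        M.point a ha ≠ M.point b hb → M.PointCol (M.point a ha) (M.point b hb) (M.point c hc) →
        a ∈ M.closure {y, z, q} → b ∈ M.closure {y, z, q} → c ∈ M.closure {y, z, q} := by
      intro a b c ha hb hc hne hcol h1 h2
      exact M.closure_subset_closure_of_subset_closure (Set.pair_subset h1 h2)
        ((pointCol_iff_mem_closure hne).1 hcol)
    have c1 := step hyz (hC.swap_right H.yxz) c0 c2
    have c3 := step hyq (hC.swap_right H.yoq) c0 c4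
    have c5 := step hzq H.zqr c2 c4
    have c6 := step hxq H.xqs c1 c4
    have : Set.range f ⊆ M.closure {y, z, q} := by
      rintro _ ⟨i, rfl⟩
      fin_cases i <;> assumption
    refine (M.eRk_mono this).trans ?_
    rw [eRk_closure_eq]
    exact (M.eRk_le_encard _).trans (encard_triple_le _ _ _)
  have good : ∀ I : Finset (Fin 7), I.card ≤ 3 → I ∉ fanoLines →
      M.Indep (f '' I) ∧ Set.InjOn f I := by
    have key : ∀ T : Finset (Fin 7), T.card ≤ 3 → M.eRk (f '' T) = 3 →
        M.Indep (f '' T) ∧ Set.InjOn f T := by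
      intro T hT3 h
      have h1 : (T : Set (Fin 7)).encard ≤ 3 := by
        rw [Set.encard_coe_eq_coe_finsetCard]; exact_mod_cast hT3
      have h2 := M.eRk_le_encard (f '' T)
      have h3 := Set.encard_image_le f (T : Set (Fin 7))
      rw [h] at h2
      refine ⟨?_, ?_⟩
      · rw [indep_iff_eRk_eq_encard_of_finite (T.finite_toSet.image f), h]
        exact le_antisymm h2 (h3.trans h1)
      · exact T.finite_toSet.injOn_of_encard_image_eq (le_antisymm h3 (h1.trans h2))
    intro I hI hIL
    obtain ⟨T, hT', hIT⟩ := exists_fano_triple_superset I hI hIL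
    suffices T.card ≤ 3 ∧ M.eRk (f '' T) = 3 by
      obtain ⟨h1, h2⟩ := key T this.1 this.2
      exact ⟨h1.subset (Set.image_mono (by exact_mod_cast hIT)), h2.mono (by exact_mod_cast hIT)⟩
    have hn := H.not_col hC
    simp only [pointCol_iff] at hn
    obtain ⟨n1, n2, n3, n4, n5, n6, n7, n8, n9, n10, n11, n12, n13, n14, n15, n16, n17, n18, n19,
      n20, n21, n22, n23, n24, n25, n26, n27, n28⟩ := hn
    simp only [Finset.mem_insert, Finset.mem_singleton] at hT'
    rcases hT' with rfl | rfl | rfl | rfl | rfl | rfl | rfl | rfl | rfl | rfl | rfl | rfl | rfl |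
      rfl | rfl | rfl | rfl | rfl | rfl | rfl | rfl | rfl | rfl | rfl | rfl | rfl | rfl | rfl <;>
    exact ⟨by decide, hT _ _ _ (by assumption)⟩
  have lines : ∀ I ∈ nonFanoLines, ¬ (M.Indep (f '' I) ∧ Set.InjOn f I) := by
    intro I hI
    simp only [nonFanoLines, Finset.mem_insert, Finset.mem_singleton] at hI
    rcases hI with rfl | rfl | rfl | rfl | rfl | rfl
    exacts [hD 0 1 2 (by decide) (pointCol_iff.1 H.yxz), hD 1 4 6 (by decide) (pointCol_iff.1 H.xqs),
      hD 0 3 4 (by decide) (pointCol_iff.1 H.yoq), hD 0 5 6 (by decide) (pointCol_iff.1 H.yrs),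
      hD 2 3 6 (by decide) (pointCol_iff.1 H.zos), hD 2 4 5 (by decide) (pointCol_iff.1 H.zqr)]
  have card : ∀ I : Finset (Fin 7), M.Indep (f '' I) ∧ Set.InjOn f I → I.card ≤ 3 := by
    rintro I ⟨h1, h2⟩
    have h3 := (h1.encard_le_eRk_of_subset (Set.image_subset_range f _)).trans rank
    rw [h2.encard_image, Set.encard_coe_eq_coe_finsetCard] at h3
    exact_mod_cast h3
  have hinj : Function.Injective f := by
    intro i j hij
    by_contra hne
    have hL : ({i, j} : Finset (Fin 7)) ∉ fanoLines := by
      intro h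
      have : ∀ l ∈ fanoLines, l.card = 3 := by decide
      have := this _ h
      rw [Finset.card_pair hne] at this
      omega
    exact hne ((good {i, j} (Finset.card_le_two.trans (by norm_num)) hL).2 (by simp) (by simp) hij)
  have main : ∀ L h3 hL, (∀ I : Finset (Fin 7), (M.Indep (f '' I) ∧ Set.InjOn f I) ↔
      I.card ≤ 3 ∧ I ∉ L) → (M ↾ Set.range f).comap f = sevenPointMatroid L h3 hL := by
    intro L h3 hL h
    refine ext_indep ?_ fun I _ => ?_
    · rw [comap_ground_eq, restrict_ground_eq, Set.preimage_range]; rfl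
    · obtain ⟨I, rfl⟩ := I.toFinite.exists_finset_coe
      rw [sevenPointMatroid_indep_iff, ← h, comap_indep_iff, restrict_indep_iff,
        and_iff_left (Set.image_subset_range _ _)]
  refine ⟨hinj, hrange, ?_⟩
  by_cases hxor : M.eRk {x, o, r} ≤ 2
  · refine Or.inl (main _ _ _ fun I => ⟨fun h => ⟨card I h, fun hI => ?_⟩, fun h => good I h.1 h.2⟩)
    rcases Finset.mem_insert.1 hI with rfl | hI
    · exact hD 1 3 5 (by decide) hxor h
    · exact lines I hI h
  · refine Or.inr (main _ _ _ fun I => ⟨fun h => ⟨card I h, fun hI => lines I hI h⟩, fun h => ?_⟩)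
    by_cases hI : I = {1, 3, 5}
    · subst hI
      have h1 := indep_triple (a := x) (b := o) (c := r) hxor
      exact ⟨by simpa [hf, Set.image_insert_eq] using h1, hinj.injOn⟩
    · exact good I h.1 fun h' => (Finset.mem_insert.1 h').elim hI h.2

theorem IsHarmonic.isHarmonicCollinearity [M.Loopless] (hM : M.IsHarmonic) :
    IsHarmonicCollinearity M.PointCol where
  toIsCollinearity := isCollinearity_pointCol
  exists_conj {y x z o q r s} H := by
    have hor := H.quadrangle_ne isCollinearity_pointCol
    have hyz := H.left_ne_right isCollinearity_pointCol
    obtain ⟨y, hy, rfl⟩ := y.exists_eq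
    obtain ⟨x, hx, rfl⟩ := x.exists_eq
    obtain ⟨z, hz, rfl⟩ := z.exists_eq
    obtain ⟨o, ho, rfl⟩ := o.exists_eq
    obtain ⟨q, hq, rfl⟩ := q.exists_eq
    obtain ⟨r, hr, rfl⟩ := r.exists_eq
    obtain ⟨s, hs, rfl⟩ := s.exists_eq
    obtain ⟨w, hw⟩ := hM.1 _ _ _ _ _ _ _ (isHP_of_harmonicConfig H)
    have hw' : w ∈ M.closure {y, z} ∩ M.closure {o, r} := hw ▸ rfl
    have hwE := M.mem_ground_of_mem_closure hw'.1
    exact ⟨M.point w hwE, (pointCol_iff_mem_closure hyz).2 hw'.1,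
      (pointCol_iff_mem_closure hor).2 hw'.2⟩
  conj_unique {y x z o q r s o' q' r' s' u v} H h1 h2 H' h1' h2' := by
    have hor1 := H.quadrangle_ne isCollinearity_pointCol
    have hor2 := H'.quadrangle_ne isCollinearity_pointCol
    have hyz := H.left_ne_right isCollinearity_pointCol
    obtain ⟨y, hy, rfl⟩ := y.exists_eq
    obtain ⟨x, hx, rfl⟩ := x.exists_eq
    obtain ⟨z, hz, rfl⟩ := z.exists_eq
    obtain ⟨o, ho, rfl⟩ := o.exists_eq
    obtain ⟨q, hq, rfl⟩ := q.exists_eq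
    obtain ⟨r, hr, rfl⟩ := r.exists_eq
    obtain ⟨s, hs, rfl⟩ := s.exists_eq
    obtain ⟨o', ho', rfl⟩ := o'.exists_eq
    obtain ⟨q', hq', rfl⟩ := q'.exists_eq
    obtain ⟨r', hr', rfl⟩ := r'.exists_eq
    obtain ⟨s', hs', rfl⟩ := s'.exists_eq
    obtain ⟨u, hu, rfl⟩ := u.exists_eq
    obtain ⟨v, hv, rfl⟩ := v.exists_eq
    rw [pointCol_iff_mem_closure hyz] at h1 h1'
    rw [pointCol_iff_mem_closure hor1] at h2
    rw [pointCol_iff_mem_closure hor2] at h2'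
    have K := isHP_of_harmonicConfig H
    have K' := isHP_of_harmonicConfig H'
    obtain ⟨w, hw⟩ := hM.1 _ _ _ _ _ _ _ K
    obtain ⟨w', hw'⟩ := hM.1 _ _ _ _ _ _ _ K'
    -- The closures meet in one element, so an arbitrary representative of the conjugate point is
    -- the conjugate element.
    have e1 : u = w := hw.subset ⟨h1, h2⟩
    have e2 : v = w' := hw'.subset ⟨h1', h2'⟩
    have := hM.2 y x z u v ⟨o, q, r, s, K, e1 ▸ hw⟩ ⟨o', q', r', s', K', e2 ▸ hw'⟩
    subst this
    rfl

theorem IsHarmonicConjugate.mem_ground {y z x x' : α} (H : M.IsHarmonicConjugate y z x x') :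
    y ∈ M.E ∧ z ∈ M.E ∧ x ∈ M.E ∧ x' ∈ M.E := by
  obtain ⟨o, q, r, s, H, h⟩ := H
  have h' : x' ∈ M.closure {y, z} ∩ M.closure {o, r} := h ▸ rfl
  exact ⟨H.mem_ground.1.1, H.mem_ground.1.2.2, H.mem_ground.1.2.1,
    M.mem_ground_of_mem_closure h'.1⟩

theorem IsHarmonicConjugate.harmonicConj [M.Loopless] {y z x x' : α}
    (H : M.IsHarmonicConjugate y z x x') (hy : y ∈ M.E) (hz : z ∈ M.E) (hx : x ∈ M.E)
    (hx' : x' ∈ M.E) :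
    HarmonicConj M.PointCol (M.point y hy) (M.point z hz) (M.point x hx) (M.point x' hx') := by
  obtain ⟨o, q, r, s, H, h⟩ := H
  have h' : x' ∈ M.closure {y, z} ∩ M.closure {o, r} := h ▸ rfl
  obtain ⟨-, ho, hq, hr, hs⟩ := H.mem_ground
  have K := H.harmonicConfig hy hx hz ho hq hr hs
  exact ⟨_, _, _, _, K,
    (pointCol_iff_mem_closure (K.left_ne_right isCollinearity_pointCol)).2 h'.1,
    (pointCol_iff_mem_closure (K.quadrangle_ne isCollinearity_pointCol)).2 h'.2⟩

theorem IsHarmonic.isHarmonicConjugate_of_harmonicConj [M.Loopless] (hM : M.IsHarmonic)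
    {y z x x' : α} {hy : y ∈ M.E} {hz : z ∈ M.E} {hx : x ∈ M.E} {hx' : x' ∈ M.E}
    (H : HarmonicConj M.PointCol (M.point y hy) (M.point z hz) (M.point x hx) (M.point x' hx')) :
    M.IsHarmonicConjugate y z x x' := by
  obtain ⟨o, q, r, s, H, h1, h2⟩ := H
  have hor := H.quadrangle_ne isCollinearity_pointCol
  have hyz := H.left_ne_right isCollinearity_pointCol
  obtain ⟨o, ho, rfl⟩ := o.exists_eq
  obtain ⟨q, hq, rfl⟩ := q.exists_eq
  obtain ⟨r, hr, rfl⟩ := r.exists_eq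
  obtain ⟨s, hs, rfl⟩ := s.exists_eq
  rw [pointCol_iff_mem_closure hyz] at h1
  rw [pointCol_iff_mem_closure hor] at h2
  have K := isHP_of_harmonicConfig H
  obtain ⟨w, hw⟩ := hM.1 _ _ _ _ _ _ _ K
  have e1 : x' = w := hw.subset ⟨h1, h2⟩
  exact ⟨o, q, r, s, K, e1 ▸ hw⟩

/-- A harmonic conjugate is the only element of its parallel class. -/
theorem IsHarmonicConjugate.eq_of_closure_eq {y z x x' e : α} (H : M.IsHarmonicConjugate y z x x')
    (he : e ∈ M.E) (h : M.closure {e} = M.closure {x'}) : e = x' := by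
  obtain ⟨o, q, r, s, -, hw⟩ := H
  have h' : x' ∈ M.closure {y, z} ∩ M.closure {o, r} := hw ▸ rfl
  have h1 : e ∈ M.closure {x'} := h ▸ M.mem_closure_self e
  exact hw.subset
    ⟨M.closure_subset_closure_of_subset_closure (Set.singleton_subset_iff.2 h'.1) h1,
      M.closure_subset_closure_of_subset_closure (Set.singleton_subset_iff.2 h'.2) h1⟩

theorem IsHP.isNonloop {y x z o q r s : α} (H : M.IsHP y x z o q r s) : M.IsNonloop z := by
  obtain ⟨L, hL, hI⟩ := isHP_indep_iff H
  have := (hI {2}).2 ⟨by simp, by rcases hL with rfl | rfl <;> decide⟩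
  simpa using this

/-! ### Conjugate sequences in a harmonic matroid -/

namespace IsConjugateSequence

variable {d : α} {b : ℕ → α}

/-- A loop lies in every closure, so it would be the only element b 2 of the intersection at step 0;
but b 2 is a nonloop in the configuration of the next step. -/
theorem loopless (hb : M.IsConjugateSequence d b) : M.Loopless := by
  rw [loopless_iff_forall_not_isLoop]
  intro e _ he
  obtain ⟨_, _, _, _, -, hw⟩ := hb 0
  obtain ⟨_, _, _, _, H, -⟩ := hb 1
  have : e = b 2 := hw.subset ⟨he.mem_closure _, he.mem_closure _⟩
  exact H.isNonloop.not_isLoop (this ▸ he)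

theorem mem_ground (hb : M.IsConjugateSequence d b) (i : ℕ) : b i ∈ M.E := (hb i).mem_ground.2.2.1

theorem mem_ground_left (hb : M.IsConjugateSequence d b) : d ∈ M.E := (hb 0).mem_ground.1

theorem ne_left (hb : M.IsConjugateSequence d b) (i : ℕ) : b i ≠ d := by
  obtain ⟨_, _, _, _, H, -⟩ := hb i
  exact fun h => H.1.ne (show (1 : Fin 7) ≠ 0 by decide) h

/-- From index 2 on every b j is a conjugate, hence alone in its parallel class. That leaves only
the pair b 0, b 1, which belongs to a simple configuration. -/
theorem eq_of_closure_eq (hb : M.IsConjugateSequence d b) {i j : ℕ}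
    (h : M.closure {b i} = M.closure {b j}) : b i = b j := by
  have := hb.loopless
  wlog hij : i < j generalizing i j
  · rcases (not_lt.1 hij).eq_or_lt with rfl | hlt
    · rfl
    · exact (this h.symm hlt).symm
  rcases j with _ | _ | j
  · omega
  · obtain rfl : i = 0 := by omega
    obtain ⟨_, _, _, _, H, -⟩ := hb 0
    obtain ⟨-, ho, hq, hr, hs⟩ := H.mem_ground
    exact absurd (point_eq_iff.2 h) (H.harmonicConfig hb.mem_ground_left (hb.mem_ground 0)
      (hb.mem_ground 1) ho hq hr hs).xz
  · exact (hb j).eq_of_closure_eq (hb.mem_ground i) h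

theorem mem_closure (hb : M.IsConjugateSequence d b) (i : ℕ) : b i ∈ M.closure {d, b 1} := by
  have hE : ({d, b 1} : Set α) ⊆ M.E := Set.pair_subset hb.mem_ground_left (hb.mem_ground 1)
  have := hb.loopless
  induction i using Nat.twoStepInduction with
  | zero =>
    obtain ⟨_, _, _, _, H, -⟩ := hb 0
    obtain ⟨-, ho, hq, hr, hs⟩ := H.mem_ground
    have K := H.harmonicConfig hb.mem_ground_left (hb.mem_ground 0) (hb.mem_ground 1) ho hq hr hs
    exact (pointCol_iff_mem_closure (K.left_ne_right isCollinearity_pointCol)).1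
      (isCollinearity_pointCol.swap_right K.yxz)
  | one => exact M.mem_closure_of_mem (by simp) hE
  | more i _ ih =>
    obtain ⟨_, _, _, _, -, hw⟩ := hb i
    have h' : b (i + 2) ∈ M.closure {d, b (i + 1)} := (hw.symm.subset rfl).1
    exact M.closure_subset_closure_of_subset_closure
      (Set.pair_subset (M.mem_closure_of_mem (by simp) hE) ih) h'

theorem isMoebiusHarmonicNet (hM : M.IsHarmonic) (hb : M.IsConjugateSequence d b) {n : ℕ}
    (hn : IsLeast {k | RepeatsAt d b k} n) :
    M.IsMoebiusHarmonicNet (insert d (Set.range b)) ∧ Function.Periodic b n := by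
  have := hb.loopless
  have hd := hb.mem_ground_left
  have hE := hb.mem_ground
  have inj : ∀ {i j}, M.point (b i) (hE i) = M.point (b j) (hE j) → b i = b j := fun h =>
    hb.eq_of_closure_eq (point_eq_iff.1 h)
  obtain ⟨m, hmn, hm⟩ := hn.1.resolve_left (hb.ne_left n)
  obtain ⟨hper, hclosed⟩ := exists_conj_of_first_repeat hM.isHarmonicCollinearity
    (D := M.point d hd) (b := fun i => M.point (b i) (hE i))
    (fun i => (hb i).harmonicConj _ _ _ _) hmn (by simp only [hm])
    (fun k hk l hl e => (hn.2 (Or.inr ⟨l, hl, inj e⟩)).not_gt hk)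
  refine ⟨⟨⟨?_, ?_⟩, ?_⟩, fun i => inj (hper i)⟩
  · rintro _ (rfl | ⟨i, rfl⟩)
    exacts [hd, hE i]
  · have hsub : insert d (Set.range b) ⊆ M.closure {d, b 1} := by
      rintro _ (rfl | ⟨i, rfl⟩)
      exacts [M.mem_closure_of_mem (by simp) (Set.pair_subset hd (hE 1)), hb.mem_closure i]
    exact (M.eRk_mono hsub).trans (by rw [eRk_closure_eq]; exact M.eRk_pair_le _ _)
  have mem : ∀ a ∈ insert d (Set.range b), ∀ ha : a ∈ M.E, M.point a ha ∈
      insert (M.point d hd) (Set.range fun i => M.point (b i) (hE i)) := by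
    rintro _ (rfl | ⟨i, rfl⟩) ha
    exacts [Or.inl rfl, Or.inr ⟨i, rfl⟩]
  have mem' : ∀ w ∈ insert (M.point d hd) (Set.range fun i => M.point (b i) (hE i)),
      ∃ a ∈ insert d (Set.range b), ∃ ha : a ∈ M.E, w = M.point a ha := by
    rintro _ (rfl | ⟨i, rfl⟩)
    exacts [⟨d, Or.inl rfl, hd, rfl⟩, ⟨b i, Or.inr ⟨i, rfl⟩, hE i, rfl⟩]
  have hstep : M.harmonicStep (insert d (Set.range b)) = insert d (Set.range b) := by
    refine Set.Subset.antisymm (Set.union_subset le_rfl ?_) Set.subset_union_left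
    rintro x ⟨hx, y, hy, v, hv, z, hz, H⟩
    obtain ⟨hyE, hzE, hvE, -⟩ := H.mem_ground
    obtain ⟨_, _, _, _, K, -, -⟩ := H.harmonicConj hyE hzE hvE hx
    -- The geometry produces some conjugate of v inside the set; uniqueness in M identifies x with
    -- it.
    obtain ⟨w, hw, hw'⟩ := hclosed _ (mem y hy hyE) _ (mem v hv hvE) _ (mem z hz hzE) K.xy K.xz
      (K.left_ne_right isCollinearity_pointCol)
    obtain ⟨a, ha, haE, rfl⟩ := mem' w hw
    rwa [hM.2 _ _ _ _ _ H (hM.isHarmonicConjugate_of_harmonicConj hw')]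
  have hiter : ∀ k, M.harmonicStep^[k] (insert d (Set.range b)) = insert d (Set.range b) :=
    fun k => Function.iterate_fixed hstep k
  rw [IsHarmonicallyClosed, harmonicClosure, Set.iUnion_congr hiter, Set.iUnion_const]

end IsConjugateSequence

end Matroid

theorem mainTheorem5 {α : Type*} (M : Matroid α) (hM : M.IsHarmonic) (d : α) (b : ℕ → α)
    (hb : M.IsConjugateSequence d b) (hmod : IsModularSequence d b) :
    M.IsMoebiusHarmonicNet (insert d (Set.range b)) ∧
      ∀ n, IsLeast {k | RepeatsAt d b k} n →
        M.IsMoebiusHarmonicNet (insert d (b '' Set.Iio n)) := by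
  classical
  have hleast : IsLeast {k | RepeatsAt d b k} (Nat.find hmod) :=
    ⟨Nat.find_spec hmod, fun _ hk => Nat.find_min' hmod hk⟩
  refine ⟨(hb.isMoebiusHarmonicNet hM hleast).1, fun n hn => ?_⟩
  obtain ⟨h1, h2⟩ := hb.isMoebiusHarmonicNet hM hn
  have hn0 : 0 < n := by
    obtain ⟨m, hm, -⟩ := hn.1.resolve_left (hb.ne_left n)
    omega
  have : b '' Set.Iio n = Set.range b := by
    refine Set.Subset.antisymm (Set.image_subset_range _ _) ?_
    rintro _ ⟨i, rfl⟩
    exact ⟨i % n, Nat.mod_lt _ hn0, h2.map_mod_nat i⟩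
  rwa [this]
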